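/- All graphs are finite, simple and undirected. For an edge-coloring (not necessarily proper) of a connected graph $F$, a path is called distance $2$-proper if any two edges of the same color on it have at least $2$ edges of the path strictly between them. Let $pc_{1,2}(F)$ be the minimum number of colors in an edge-coloring of $F$ for which any two distinct vertices are connected by a distance $2$-proper path. A star is a graph $K_{1,n}$ with $n\ge 1$ (so $K_2$ is a star), and the radius of a connected graph is the minimum, over its vertices $x$, of the maximum distance from $x$ to a vertex. The Cartesian product $G\square H$ has vertex set $V(G)\times V(H)$, with $(u,v)$ adjacent to $(x,y)$ if and only if either $ux\in E(G)$ and $v=y$, or $u=x$ and $vy\in E(H)$. **Theorem 4.2.** Let $G$ and $H$ be connected graphs, each with at least two vertices, that are not both complete. Call the pair $\{G,H\}$ exceptional if $G$ is a star and every spanning tree of $H$ has radius at least $3$, or $H$ is a star and every spanning tree of $G$ has radius at least $3$. (i) If the pair is not exceptional, then $pc_{1,2}(G\square H)=3$. (ii) If the pair is exceptional, then $pc_{1,2}(G\square H)\le 4$. -/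

import Mathlib

namespace SimpleGraph

variable {V : Type*}

/-- Let `c` be an edge-coloring of `G` (not necessarily proper). The walk `p`, with consecutive
edges `e₀, e₁, …`, is *distance `ℓ`-proper* if no two edges of the same color appear on it with
fewer than `ℓ` edges in between: if `i < j` and `eᵢ`, `eⱼ` have the same color, then at least `ℓ`
edges lie strictly between them, i.e. `ℓ ≤ j - i - 1`. -/
def IsDistanceProper {G : SimpleGraph V} {K : Type*} (c : G.EdgeLabeling K) (ℓ : ℕ) {u v : V}
    (p : G.Walk u v) : Prop :=
  ∀ (i j : ℕ) (hi : i < p.edges.length) (hj : j < p.edges.length), i < j →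
    c ⟨p.edges[i], p.edges_subset_edgeSet (List.getElem_mem hi)⟩ =
      c ⟨p.edges[j], p.edges_subset_edgeSet (List.getElem_mem hj)⟩ →
    i + ℓ + 1 ≤ j

/-- The edge-coloring `c` is a `(k, ℓ)`-*proper-path coloring* of `G`: any two distinct vertices are
connected by `k` (distinct) pairwise internally vertex-disjoint distance `ℓ`-proper paths. -/
def IsProperPathColoring {G : SimpleGraph V} {K : Type*} (k ℓ : ℕ) (c : G.EdgeLabeling K) : Prop :=
  ∀ u v : V, u ≠ v → ∃ P : Fin k → G.Path u v, Function.Injective P ∧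
    (∀ a b : Fin k, a ≠ b → ∀ w : V, w ∈ (P a : G.Walk u v).support →
      w ∈ (P b : G.Walk u v).support → w = u ∨ w = v) ∧
    ∀ a : Fin k, IsDistanceProper c ℓ (P a : G.Walk u v)

/-- The `(k, ℓ)`-*proper connection number* `pc_{k,ℓ}(G)`: the least number `t` of colors in a
`(k, ℓ)`-proper-path coloring of `G` (it is `⊤` if there is no such coloring with finitely many
colors). -/
noncomputable def properConnectionNumber (k ℓ : ℕ) (G : SimpleGraph V) : ℕ∞ :=
  ⨅ t ∈ {t : ℕ | ∃ c : G.EdgeLabeling (Fin t), IsProperPathColoring k ℓ c}, (t : ℕ∞)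

/-- `G` is a star: some vertex `r` is adjacent to all other vertices, and there are no other
edges. In particular `K₂` is a star. -/
def IsStar (G : SimpleGraph V) : Prop :=
  ∃ r : V, G = starGraph r

/-- `T` is a spanning tree of `G`. (All vertices of `G` are vertices of `T` by typing.) -/
def IsSpanningTree (T G : SimpleGraph V) : Prop :=
  T ≤ G ∧ T.IsTree

/-- The exceptional pairs `(G, H)`: `G` is a star and every spanning tree of `H` has radius at
least `3`. -/
def IsStarLargeRadiusPair {W : Type*} (G : SimpleGraph V) (H : SimpleGraph W) : Prop :=
  G.IsStar ∧ ∀ T : SimpleGraph W, T.IsSpanningTree H → 3 ≤ T.radius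

end SimpleGraph

/-!
Let `X = G □ H`. A path is distance `2`-proper when any three consecutive edges have different
colors, so with three colors the colors along it form an arithmetic progression modulo `3` with
difference `±1`. As `G` and `H` are not both complete, some two vertices of `X` are at distance at
least `3`, and three colors are needed.

*Both factors have at least three vertices.* Here three colors always suffice. A potential
`φ : X → ZMod 3` directs the edges along which it increases by `1`; coloring each of them by the
potential of its tail makes every directed path distance `2`-proper
(`linked_of_reflTransGen_arc`), so a potential whose digraph is strongly connected is enough. Such
a potential is assembled from pieces: if two strongly connected pieces are joined by two edges and
the potential is not constant on the ends of these edges in one of the pieces, then replacing `φ`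
by `±φ + k` on the other piece merges them (`exists_mutual_of_glued`). The pieces come from
skeletons of the factors. In a rooted spanning tree, a greedy choice of centres
(`RootedTree.nonempty_skeleton`) decomposes the factor into parts in which isolated centres (hubs)
see neighbors (spokes) of both signs, and parts that locally look like the path `P₄` with four
vertices. Over the first kind of part the potential `0, ±1`, alternating along the other factor, is
strongly connected, as it is composed of directed hexagons; over two parts of the second kind a
strongly connected potential on `P₄ □ P₄` is pulled back. The lemma `Skeleton.glued` checks that
these pieces are joined as required.

*One factor is `K₂`.* This is a star, so the pair is exceptional unless the other factor has a
spanning tree of radius at most `2`, and then an explicit coloring with three colors works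
(`exists_linked_three_of_prism`): any two vertices lie together on one of seven kinds of paths. In
general, four colors suffice (`exists_linked_four_of_prism`): on the two sides of the prism the
colors count the depth in a rooted spanning tree upwards and downwards, so that one can climb to the
root on one side and descend on the other, and the fourth color serves to change sides once more at
one end.
-/

namespace SimpleGraph

/-! ### Colour sequences along paths -/

/-- Equal entries of the list are at least three positions apart. For the colours along a path this
is distance `2`-properness. -/
def Spaced {K : Type*} (l : List K) : Prop :=
  ∀ (i j : ℕ) (hi : i < l.length) (hj : j < l.length), i < j → l[i] = l[j] → i + 3 ≤ j

/-- Some path from `u` to `v` is distance `2`-proper. The coloring is defined on all of `Sym2 X`, so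
that it can be given by a formula; its values off the edge set play no role. -/
def Linked {X K : Type*} (G : SimpleGraph X) (col : Sym2 X → K) (u v : X) : Prop :=
  ∃ p : G.Walk u v, p.IsPath ∧ Spaced (p.edges.map col)

section Spaced

variable {K L : Type*}

theorem Spaced.reverse {l : List K} (h : Spaced l) : Spaced l.reverse := by
  intro i j hi hj hij he
  simp only [List.length_reverse] at hi hj
  simp only [List.getElem_reverse] at he
  have := h (l.length - 1 - j) (l.length - 1 - i) (by omega) (by omega) (by omega) he.symm
  omega

theorem Spaced.map {l : List K} (h : Spaced l) {f : K → L} (hf : Function.Injective f) :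
    Spaced (l.map f) := by
  intro i j hi hj hij he
  simp only [List.length_map] at hi hj
  simp only [List.getElem_map] at he
  exact h i j hi hj hij (hf he)

theorem Spaced.cons {l : List K} (h : Spaced l) {a : K} (ha : a ∉ l) : Spaced (a :: l) := by
  intro i j hi hj hij he
  obtain ⟨j, rfl⟩ : ∃ k, j = k + 1 := ⟨j - 1, by omega⟩
  rcases i with _ | i
  · simp only [List.getElem_cons_zero, List.getElem_cons_succ] at he
    exact absurd (he ▸ List.getElem_mem _) ha
  · simp only [List.getElem_cons_succ] at he
    have := h i j (by simpa using hi) (by simpa using hj) (by omega) he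
    omega

/-- An arithmetic progression modulo `3` is spaced: equal terms are a multiple of `3` apart. -/
theorem spaced_of_isChain {ε : ZMod 3} (hε : ε ≠ 0) {l : List (ZMod 3)}
    (h : l.IsChain fun x y => y = x + ε) : Spaced l := by
  have key : ∀ (k i : ℕ) (hk : i + k < l.length), l[i + k] = l[i] + k * ε := by
    intro k
    induction k with
    | zero => intro i hk; simp
    | succ k ih =>
      intro i hk
      have h1 := (List.isChain_iff_getElem.1 h) (i + k) (by omega)
      have h2 := ih i (by omega)
      have h3 : l[i + (k + 1)] = l[i + k] + ε := h1
      rw [h3, h2]; push_cast; ring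
  intro i j hi hj hij he
  obtain ⟨k, rfl⟩ : ∃ k, j = i + k := ⟨j - i, by omega⟩
  rw [key k i hj] at he
  have h0 : (k : ZMod 3) * ε = 0 := by simpa using he
  have : Fact (Nat.Prime 3) := ⟨Nat.prime_three⟩
  have hk : (k : ZMod 3) = 0 := (mul_eq_zero.1 h0).resolve_right hε
  have := Nat.le_of_dvd (by omega) ((ZMod.natCast_eq_zero_iff k 3).1 hk)
  omega

end Spaced

section Linked

variable {X Y K : Type*} {G : SimpleGraph X} {G' : SimpleGraph Y}

theorem Linked.symm {col : Sym2 X → K} {u v : X} (h : G.Linked col u v) : G.Linked col v u := by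
  obtain ⟨p, hp, hs⟩ := h
  refine ⟨p.reverse, hp.reverse, ?_⟩
  rw [Walk.edges_reverse, List.map_reverse]
  exact hs.reverse

/-- A path whose colours form an arithmetic progression modulo `3` is distance `2`-proper. -/
theorem Linked.of_isChain {col : Sym2 X → ZMod 3} {ε : ZMod 3} (hε : ε ≠ 0) {u v : X}
    (p : G.Walk u v) (hp : p.IsPath) (h : (p.edges.map col).IsChain fun x y => y = x + ε) :
    G.Linked col u v :=
  ⟨p, hp, spaced_of_isChain hε h⟩

theorem Linked.of_iso {col : Sym2 X → K} (e : G' ≃g G) {u v : Y}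
    (h : G.Linked col (e u) (e v)) : G'.Linked (col ∘ Sym2.map e) u v := by
  obtain ⟨p, hp, hs⟩ := h
  have hu : e.symm (e u) = u := e.symm_apply_apply u
  have hv : e.symm (e v) = v := e.symm_apply_apply v
  refine ⟨(p.map e.symm.toHom).copy hu hv, ?_, ?_⟩
  · rw [Walk.isPath_copy]
    exact hp.map e.symm.injective
  · rw [Walk.edges_copy, Walk.edges_map, List.map_map]
    convert hs using 2
    funext z
    induction z with
    | _ a b => simp [Sym2.map_mk]

/-- A coloring with `t` colors in which all pairs are linked bounds `pc_{1,2}` by `t`. -/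
theorem properConnectionNumber_le_of_linked [Fintype K] {t : ℕ} (ht : Fintype.card K = t)
    (h : ∃ col : Sym2 X → K, ∀ u v, G.Linked col u v) : G.properConnectionNumber 1 2 ≤ t := by
  obtain ⟨col, h⟩ := h
  let f : K ≃ Fin t := Fintype.equivFinOfCardEq ht
  refine iInf₂_le (α := ℕ∞) t ⟨fun e => f (col e.1), ?_⟩
  intro u v _
  obtain ⟨p, hp, hs⟩ := h u v
  refine ⟨fun _ => ⟨p, hp⟩, fun a b _ => Subsingleton.elim a b,
    fun a b hab => absurd (Subsingleton.elim a b) hab, fun _ => ?_⟩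
  intro i j hi hj hij he
  have := hs i j (by simpa using hi) (by simpa using hj) hij (by simpa using f.injective he)
  omega

/-- Two vertices at distance at least `3` force three colors: the first three edges of a distance
`2`-proper path have distinct colors. -/
theorem three_le_properConnectionNumber {u v : X} (huv : 3 ≤ G.edist u v) :
    3 ≤ G.properConnectionNumber 1 2 := by
  refine le_iInf₂ fun t ht => ?_
  obtain ⟨c, hc⟩ := ht
  have hne : u ≠ v := by
    rintro rfl
    simp at huv
  obtain ⟨P, -, -, hP⟩ := hc u v hne
  have hlen : 3 ≤ (P 0 : G.Walk u v).edges.length := by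
    have := huv.trans ((P 0 : G.Walk u v).edist_le)
    rw [Walk.length_edges]
    exact_mod_cast this
  let g : Fin 3 → Fin t := fun i =>
    c ⟨(P 0 : G.Walk u v).edges[(i : ℕ)]'(by omega),
      (P 0 : G.Walk u v).edges_subset_edgeSet (List.getElem_mem _)⟩
  have hg : Function.Injective g := by
    intro i j hij
    by_contra hne
    rcases lt_or_gt_of_ne hne with h | h
    · have := hP 0 i j (by omega) (by omega) h hij
      omega
    · have := hP 0 j i (by omega) (by omega) h hij.symm
      omega
  have := Fintype.card_le_of_injective g hg
  simp only [Fintype.card_fin] at this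
  exact_mod_cast this

end Linked

theorem two_le_edist_of_ne_top {X : Type*} {G : SimpleGraph X} (h : G ≠ ⊤) :
    ∃ u v, 2 ≤ G.edist u v := by
  obtain ⟨u, v, huv, hadj⟩ : ∃ u v, u ≠ v ∧ ¬ G.Adj u v := by
    by_contra! H
    exact h (eq_top_iff.2 fun a b hab => H a b hab)
  refine ⟨u, v, ?_⟩
  have h0 : G.edist u v ≠ 0 := by simpa [edist_eq_zero_iff] using huv
  have h1 : G.edist u v ≠ 1 := by simpa [edist_eq_one_iff_adj] using hadj
  have h2 : 1 ≤ G.edist u v := Order.one_le_iff_ne_zero.2 h0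
  have h3 := Order.add_one_le_of_lt (lt_of_le_of_ne h2 (Ne.symm h1))
  simpa [one_add_one_eq_two] using h3

theorem one_le_edist_of_nontrivial {X : Type*} [Nontrivial X] (G : SimpleGraph X) :
    ∃ u v, 1 ≤ G.edist u v := by
  obtain ⟨u, v, huv⟩ := exists_pair_ne X
  exact ⟨u, v, Order.one_le_iff_ne_zero.2 (by simpa [edist_eq_zero_iff] using huv)⟩

theorem three_le_properConnectionNumber_boxProd {V W : Type*} [Nontrivial V] [Nontrivial W]
    (G : SimpleGraph V) (H : SimpleGraph W) (hGH : ¬ (G = ⊤ ∧ H = ⊤)) :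
    3 ≤ (G □ H).properConnectionNumber 1 2 := by
  by_cases hG : G = ⊤
  · obtain ⟨c, d, hcd⟩ := two_le_edist_of_ne_top fun hH => hGH ⟨hG, hH⟩
    obtain ⟨a, b, hab⟩ := one_le_edist_of_nontrivial G
    refine three_le_properConnectionNumber (u := (a, c)) (v := (b, d)) ?_
    rw [edist_boxProd]
    exact (by norm_num : (3 : ℕ∞) = 1 + 2).le.trans (add_le_add hab hcd)
  · obtain ⟨a, b, hab⟩ := two_le_edist_of_ne_top hG
    obtain ⟨c, d, hcd⟩ := one_le_edist_of_nontrivial H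
    refine three_le_properConnectionNumber (u := (a, c)) (v := (b, d)) ?_
    rw [edist_boxProd]
    exact (by norm_num : (3 : ℕ∞) = 2 + 1).le.trans (add_le_add hab hcd)

/-! ### Potentials modulo three -/

section Potential

variable {X : Type*} (G : SimpleGraph X)

/-- The arcs of a potential `φ : X → ZMod 3`: the edges of `G`, directed so that `φ` increases
by `1`. Edges whose ends have equal potential are not used. -/
def Arc (φ : X → ZMod 3) (a b : X) : Prop :=
  G.Adj a b ∧ φ b = φ a + 1

/-- `a` and `b` lie in the same strongly connected component of the digraph of arcs of `φ`. -/
def Mutual (φ : X → ZMod 3) (a b : X) : Prop :=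
  Relation.ReflTransGen (G.Arc φ) a b ∧ Relation.ReflTransGen (G.Arc φ) b a

/-- The coloring of a potential: an arc is colored by the potential of its tail. -/
def potentialColor (φ : X → ZMod 3) : Sym2 X → ZMod 3 :=
  Sym2.lift ⟨fun a b => if φ b = φ a + 1 then φ a else φ b, by
    intro a b
    have : ∀ x y : ZMod 3, (if y = x + 1 then x else y) = if x = y + 1 then y else x := by decide
    exact this _ _⟩

variable {G} {φ : X → ZMod 3} {a b c : X}

theorem Mutual.refl (a : X) : G.Mutual φ a a := ⟨.refl, .refl⟩

theorem Mutual.symm (h : G.Mutual φ a b) : G.Mutual φ b a := ⟨h.2, h.1⟩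

theorem Mutual.trans (h : G.Mutual φ a b) (h' : G.Mutual φ b c) : G.Mutual φ a c :=
  ⟨h.1.trans h'.1, h'.2.trans h.2⟩

/-- Along a directed walk the colors increase by `1` at each step, and this survives shortcutting
the walk to a path, because the color of an arc depends on its tail only. -/
theorem linked_of_reflTransGen_arc (h : Relation.ReflTransGen (G.Arc φ) a b) :
    G.Linked (potentialColor φ) a b := by
  classical
  have hw : ∃ p : G.Walk a b, ∀ d ∈ p.darts, φ d.snd = φ d.fst + 1 := by
    induction h with
    | refl => exact ⟨.nil, by simp⟩
    | tail _ hbc ih =>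
      obtain ⟨p, hp⟩ := ih
      refine ⟨p.concat hbc.1, fun d hd => ?_⟩
      rw [Walk.darts_concat, List.concat_eq_append, List.mem_append, List.mem_singleton] at hd
      rcases hd with hd | rfl
      · exact hp d hd
      · exact hbc.2
  obtain ⟨p, hp⟩ := hw
  refine Linked.of_isChain one_ne_zero p.bypass p.bypass_isPath ?_
  have hq : ∀ d ∈ p.bypass.darts, φ d.snd = φ d.fst + 1 :=
    fun d hd => hp d (p.darts_bypass_subset_darts hd)
  have hcol : ∀ d ∈ p.bypass.darts, potentialColor φ d.edge = φ d.fst := by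
    intro d hd
    have := hq d hd
    rcases d with ⟨⟨x, y⟩, hxy⟩
    simp only at this
    simp [potentialColor, Dart.edge, this]
  rw [Walk.edges, List.map_map, List.isChain_map]
  have hchain := p.bypass.isChain_dartAdj_darts
  rw [List.isChain_iff_getElem] at hchain ⊢
  intro i hi
  have h1 := hchain i hi
  simp only [Function.comp_apply]
  rw [hcol _ (List.getElem_mem _), hcol _ (List.getElem_mem _), ← hq _ (List.getElem_mem _)]
  exact congrArg φ h1.symm

/-- The elements of a closed directed walk are mutually reachable. -/
theorem Mutual.of_closed_chain {l : List X} (h : (l ++ l).IsChain (G.Arc φ)) (ha : a ∈ l)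
    (hb : b ∈ l) : G.Mutual φ a b := by
  have hp : (l ++ l).Pairwise (Relation.ReflTransGen (G.Arc φ)) :=
    List.isChain_iff_pairwise.1 (h.imp fun _ _ hxy => Relation.ReflTransGen.single hxy)
  have := (List.pairwise_append.1 hp).2.2
  exact ⟨this a ha b hb, this b hb a ha⟩

end Potential

/-! ### Merging strongly connected components -/

section Merge

variable {X : Type*} {G : SimpleGraph X} {φ : X → ZMod 3}

/-- The equivalence relation generated by mutual reachability and by *bridges*: two edges `a₁b₁`,
`a₂b₂` between the component of `a₁`, `a₂` and that of `b₁`, `b₂`, where the potential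
distinguishes `a₁` from `a₂` or `b₁` from `b₂`. -/
inductive Glued (G : SimpleGraph X) (φ : X → ZMod 3) : X → X → Prop
  | of_mutual {a b : X} : G.Mutual φ a b → Glued G φ a b
  | bridge {a₁ a₂ b₁ b₂ : X} : G.Mutual φ a₁ a₂ → G.Mutual φ b₁ b₂ → G.Adj a₁ b₁ → G.Adj a₂ b₂ →
      (φ a₁ ≠ φ a₂ ∨ φ b₁ ≠ φ b₂) → Glued G φ a₁ b₁
  | symm {a b : X} : Glued G φ a b → Glued G φ b a
  | trans {a b c : X} : Glued G φ a b → Glued G φ b c → Glued G φ a c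

theorem Glued.refl (a : X) : Glued G φ a a := .of_mutual (.refl a)

/-- A path between mutually reachable vertices stays in their component. -/
theorem reflTransGen_and_of_mutual {r : X → X → Prop} {a b : X} (h : Relation.ReflTransGen r a b)
    (h' : Relation.ReflTransGen r b a) :
    Relation.ReflTransGen (fun x y => r x y ∧ Relation.ReflTransGen r y x) a b := by
  induction h with
  | refl => exact .refl
  | tail hab hbc ih => exact (ih (.head hbc h')).tail ⟨hbc, h'.trans hab⟩

/-- Replacing the potential on one component by `ε * φ + k` keeps all components connected: for
`ε = -1` the arcs inside that component are reversed. -/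
theorem Mutual.affine {φ' : X → ZMod 3} {c : X} {ε k : ZMod 3} (hε : ε ≠ 0)
    (hin : ∀ x, G.Mutual φ c x → φ' x = ε * φ x + k) (hout : ∀ x, ¬ G.Mutual φ c x → φ' x = φ x)
    {a b : X} (h : G.Mutual φ a b) : G.Mutual φ' a b := by
  have hε' : ∀ e : ZMod 3, e ≠ 0 → e ≠ -1 → e = 1 := by decide
  have key : ∀ {x y : X}, G.Mutual φ x y →
      (ε = -1 ∧ G.Mutual φ c x → Relation.ReflTransGen (G.Arc φ') y x) ∧
      (¬ (ε = -1 ∧ G.Mutual φ c x) → Relation.ReflTransGen (G.Arc φ') x y) := by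
    intro x y hxy
    have hr := reflTransGen_and_of_mutual hxy.1 hxy.2
    clear hxy
    by_cases hx : G.Mutual φ c x
    · have hmem : ∀ {u v}, (G.Arc φ u v ∧ Relation.ReflTransGen (G.Arc φ) v u) →
          G.Mutual φ c u → G.Mutual φ c v := fun huv hu => hu.trans ⟨.single huv.1, huv.2⟩
      by_cases he : ε = -1
      · refine ⟨fun _ => ?_, fun hn => absurd ⟨he, hx⟩ hn⟩
        suffices H : G.Mutual φ c y ∧ Relation.ReflTransGen (G.Arc φ') y x from H.2
        induction hr with
        | refl => exact ⟨hx, .refl⟩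
        | tail _ huv ih =>
          refine ⟨hmem huv ih.1, ih.2.head ⟨huv.1.1.symm, ?_⟩⟩
          rw [hin _ ih.1, hin _ (hmem huv ih.1), huv.1.2, he]; ring
      · refine ⟨fun hn => absurd hn.1 he, fun _ => ?_⟩
        suffices H : G.Mutual φ c y ∧ Relation.ReflTransGen (G.Arc φ') x y from H.2
        induction hr with
        | refl => exact ⟨hx, .refl⟩
        | tail _ huv ih =>
          refine ⟨hmem huv ih.1, ih.2.tail ⟨huv.1.1, ?_⟩⟩
          rw [hin _ ih.1, hin _ (hmem huv ih.1), huv.1.2, hε' ε hε he]; ring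
    · have hmem : ∀ {u v}, (G.Arc φ u v ∧ Relation.ReflTransGen (G.Arc φ) v u) →
          ¬ G.Mutual φ c u → ¬ G.Mutual φ c v :=
        fun huv hu hv => hu (hv.trans ⟨huv.2, .single huv.1⟩)
      refine ⟨fun hn => absurd hn.2 hx, fun _ => ?_⟩
      suffices H : ¬ G.Mutual φ c y ∧ Relation.ReflTransGen (G.Arc φ') x y from H.2
      induction hr with
      | refl => exact ⟨hx, .refl⟩
      | tail _ huv ih =>
        refine ⟨hmem huv ih.1, ih.2.tail ⟨huv.1.1, ?_⟩⟩
        rw [hout _ ih.1, hout _ (hmem huv ih.1), huv.1.2]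
  by_cases ha : ε = -1 ∧ G.Mutual φ c a
  · exact ⟨(key h.symm).1 ⟨ha.1, ha.2.trans h⟩, (key h).1 ha⟩
  · exact ⟨(key h).2 ha, (key h.symm).2 fun hb => ha ⟨hb.1, hb.2.trans h.symm⟩⟩

/-- If mutual reachability and bridges together connect all vertices, then some potential is
strongly connected. Among the potentials that keep the components of `φ` connected and keep
different values in a component different, the one with the most mutually reachable pairs works:
across a bridge between two components, an affine change of the potential on one of them yields
arcs in both directions. -/
theorem exists_mutual_of_glued [Finite X] (h : ∀ a b, Glued G φ a b) :
    ∃ ψ, ∀ a b, G.Mutual ψ a b := by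
  classical
  let A := {ψ : X → ZMod 3 // ∀ a b, G.Mutual φ a b → G.Mutual ψ a b ∧ (φ a ≠ φ b → ψ a ≠ ψ b)}
  have : Nonempty A := ⟨φ, fun a b hab => ⟨hab, id⟩⟩
  obtain ⟨⟨ψ, hψ⟩, hmax⟩ := Finite.exists_max
    fun ψ : A => {p : X × X | G.Mutual ψ.1 p.1 p.2}.ncard
  refine ⟨ψ, fun a b => ?_⟩
  have hab := h a b
  induction hab with
  | of_mutual hm => exact (hψ _ _ hm).1
  | symm _ ih => exact ih.symm
  | trans _ _ ih1 ih2 => exact ih1.trans ih2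
  | @bridge a₁ a₂ b₁ b₂ ha hb h1 h2 hne =>
    by_contra hnot
    have hψa := (hψ _ _ ha).1
    have hψb := (hψ _ _ hb).1
    have hne' : ψ a₁ ≠ ψ a₂ ∨ ψ b₁ ≠ ψ b₂ := hne.imp (hψ _ _ ha).2 (hψ _ _ hb).2
    have solve : ∀ x y z w : ZMod 3, x ≠ y ∨ z ≠ w → ∃ ε k : ZMod 3, ε ≠ 0 ∧
        ((ε * z + k = x + 1 ∧ y = ε * w + k + 1) ∨ (x = ε * z + k + 1 ∧ ε * w + k = y + 1)) := by
      decide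
    obtain ⟨ε, k, hε, hk⟩ := solve _ _ _ _ hne'
    let ψ' : X → ZMod 3 := fun x => if G.Mutual ψ b₁ x then ε * ψ x + k else ψ x
    have hin : ∀ x, G.Mutual ψ b₁ x → ψ' x = ε * ψ x + k := fun x hx => if_pos hx
    have hout : ∀ x, ¬ G.Mutual ψ b₁ x → ψ' x = ψ x := fun x hx => if_neg hx
    have haff : ∀ {x y}, G.Mutual ψ x y → G.Mutual ψ' x y := Mutual.affine hε hin hout
    have hnew : G.Mutual ψ' a₁ b₁ := by
      have e1 : ψ' a₁ = ψ a₁ := hout _ fun hm => hnot hm.symm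
      have e2 : ψ' a₂ = ψ a₂ := hout _ fun hm => hnot (hm.trans hψa.symm).symm
      have e3 : ψ' b₁ = ε * ψ b₁ + k := hin _ (.refl _)
      have e4 : ψ' b₂ = ε * ψ b₂ + k := hin _ hψb
      rcases hk with ⟨k1, k2⟩ | ⟨k1, k2⟩
      · have s1 : G.Arc ψ' a₁ b₁ := ⟨h1, by rw [e1, e3, k1]⟩
        have s2 : G.Arc ψ' b₂ a₂ := ⟨h2.symm, by rw [e2, e4, ← k2]⟩
        exact ⟨.single s1, ((haff hψb).1.tail s2).trans (haff hψa).2⟩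
      · have s1 : G.Arc ψ' b₁ a₁ := ⟨h1.symm, by rw [e1, e3, ← k1]⟩
        have s2 : G.Arc ψ' a₂ b₂ := ⟨h2, by rw [e2, e4, k2]⟩
        exact ⟨((haff hψa).1.tail s2).trans (haff hψb).2, .single s1⟩
    have hadm : ∀ a b, G.Mutual φ a b → G.Mutual ψ' a b ∧ (φ a ≠ φ b → ψ' a ≠ ψ' b) := by
      intro a b hab
      have hab' := hψ a b hab
      refine ⟨haff hab'.1, fun hn => ?_⟩
      by_cases hm : G.Mutual ψ b₁ a
      · rw [hin _ hm, hin _ (hm.trans hab'.1)]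
        have inj : ∀ e x y k : ZMod 3, e ≠ 0 → e * x + k = e * y + k → x = y := by decide
        exact fun he => hab'.2 hn (inj _ _ _ _ hε he)
      · rw [hout _ hm, hout _ fun hb => hm (hb.trans hab'.1.symm)]
        exact hab'.2 hn
    have hlt : {p : X × X | G.Mutual ψ p.1 p.2}.ncard <
        {p : X × X | G.Mutual ψ' p.1 p.2}.ncard := by
      refine Set.ncard_lt_ncard ⟨fun p hp => haff hp, fun hsub => ?_⟩ (Set.toFinite _)
      exact hnot (hsub (show (a₁, b₁) ∈ {p : X × X | G.Mutual ψ' p.1 p.2} from hnew))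
    exact absurd (hmax ⟨ψ', hadm⟩) (not_le.2 hlt)

/-- A graph with a potential all of whose vertices are glued has a coloring with three colors in
which all pairs of vertices are linked. -/
theorem exists_linked_of_glued [Finite X] (h : ∀ a b, Glued G φ a b) :
    ∃ col : Sym2 X → ZMod 3, ∀ u v, G.Linked col u v := by
  obtain ⟨ψ, hψ⟩ := exists_mutual_of_glued h
  exact ⟨potentialColor ψ, fun u v => linked_of_reflTransGen_arc (hψ u v).1⟩

end Merge

/-! ### Skeletons and the potential on a product -/

/-- Consecutive positions on a path with four vertices. -/
def IsConsecutive (i j : Fin 4) : Prop :=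
  (i : ℕ) + 1 = j ∨ (j : ℕ) + 1 = i

instance : DecidableRel IsConsecutive := fun i j =>
  inferInstanceAs (Decidable ((i : ℕ) + 1 = j ∨ (j : ℕ) + 1 = i))

/-- A *skeleton* of `G`: a connected bipartite spanning subgraph `E` of `G`, with the bipartition
given by `sgn = ±1`, together with a role for each vertex. Role `inl 0` is that of a *hub*, roles
`inl 1` and `inl (-1)` are those of *spokes*, and role `inr i` means that the vertex plays the
`i`-th vertex of a path with four vertices. Every hub has spokes of both signs as neighbors and no
other neighbors in `E`, every spoke is adjacent to a hub, and each vertex of role `inr i` has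
neighbors of all the roles that are next to `i` on the path; besides consecutive positions, only the
two ends of the path may be adjacent in `E`. -/
structure Skeleton {V : Type*} (G : SimpleGraph V) where
  /-- adjacency in the spanning subgraph -/
  E : V → V → Prop
  /-- the bipartition -/
  sgn : V → ZMod 3
  /-- the role of a vertex -/
  role : V → ZMod 3 ⊕ Fin 4
  adj : ∀ {u v}, E u v → G.Adj u v
  symm : ∀ {u v}, E u v → E v u
  conn : ∀ u v, Relation.ReflTransGen E u v
  sgn_eq : ∀ v, sgn v = 1 ∨ sgn v = -1
  flip : ∀ {u v}, E u v → sgn v = -sgn u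
  exists_spoke : ∀ {z}, role z = .inl 0 → ∀ a : ZMod 3, a ≠ 0 → ∃ n, E z n ∧ role n = .inl a
  spoke_of_hub : ∀ {z n}, role z = .inl 0 → E z n → ∃ a : ZMod 3, a ≠ 0 ∧ role n = .inl a
  exists_hub : ∀ {n a}, role n = .inl a → a ≠ 0 → ∃ z, E n z ∧ role z = .inl 0
  exists_next : ∀ {u i}, role u = .inr i → ∀ j, IsConsecutive i j → ∃ v, E u v ∧ role v = .inr j
  path_edge : ∀ {u v i j}, role u = .inr i → role v = .inr j → E u v →
    IsConsecutive i j ∨ (i = 0 ∧ j = 3) ∨ (i = 3 ∧ j = 0)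

/-- A strongly connected potential on the product of two paths with four vertices. -/
def gridPotential : Fin 4 → Fin 4 → ZMod 3 :=
  ![![1, 2, 0, 1], ![0, 0, 1, 2], ![2, 1, 0, 0], ![1, 0, 2, 1]]

/-- A closed directed walk for `gridPotential` that visits all vertices. -/
def gridTour : List (Fin 4 × Fin 4) :=
  [(3, 0), (2, 0), (1, 0), (0, 0), (0, 1), (1, 1), (1, 2), (1, 3), (2, 3), (3, 3), (3, 2), (2, 2),
    (2, 1), (2, 0), (1, 0), (0, 0), (0, 1), (0, 2), (0, 3), (1, 3), (2, 3), (3, 3), (3, 2), (3, 1)]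

theorem mem_gridTour : ∀ x, x ∈ gridTour := by decide

theorem isChain_gridTour : (gridTour ++ gridTour).IsChain fun x y =>
    ((x.2 = y.2 ∧ IsConsecutive x.1 y.1) ∨ (x.1 = y.1 ∧ IsConsecutive x.2 y.2)) ∧
      gridPotential y.1 y.2 = gridPotential x.1 x.2 + 1 := by
  decide

/-- A hexagon with potentials `0, s, -s, 0, s, -s`, where `s = ±1`, is a directed cycle. -/
theorem Mutual.of_hexagon {X : Type*} {G : SimpleGraph X} {φ : X → ZMod 3} {s : ZMod 3}
    (hs : s = 1 ∨ s = -1) {a b b' a' c' c : X} (h₁ : G.Adj a b) (h₂ : G.Adj b b')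
    (h₃ : G.Adj b' a') (h₄ : G.Adj a' c') (h₅ : G.Adj c' c) (h₆ : G.Adj c a)
    (ha : φ a = 0) (ha' : φ a' = 0) (hb : φ b = s) (hb' : φ b' = -s) (hc : φ c = -s)
    (hc' : φ c' = s) :
    G.Mutual φ a b ∧ G.Mutual φ a a' ∧ G.Mutual φ a b' := by
  rcases hs with rfl | rfl
  · have hch : ([a, b, b', a', c', c] ++ [a, b, b', a', c', c]).IsChain (G.Arc φ) := by
      simp [Arc, h₁, h₂, h₃, h₄, h₅, h₆, ha, ha', hb, hb', hc, hc']
      decide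
    exact ⟨.of_closed_chain hch (by simp) (by simp), .of_closed_chain hch (by simp) (by simp),
      .of_closed_chain hch (by simp) (by simp)⟩
  · have hch : ([a, c, c', a', b', b] ++ [a, c, c', a', b', b]).IsChain (G.Arc φ) := by
      simp [Arc, h₁.symm, h₂.symm, h₃.symm, h₄.symm, h₅.symm, h₆.symm, ha, ha', hb, hb', hc, hc']
      decide
    exact ⟨.of_closed_chain hch (by simp) (by simp), .of_closed_chain hch (by simp) (by simp),
      .of_closed_chain hch (by simp) (by simp)⟩

namespace Skeleton

variable {V W : Type*} {G : SimpleGraph V} {H : SimpleGraph W} (S : Skeleton G) (T : Skeleton H)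

theorem exists_adj (v : V) : ∃ v', S.E v v' := by
  rcases h : S.role v with a | i
  · by_cases ha : a = 0
    · obtain ⟨n, hn, -⟩ := S.exists_spoke (ha ▸ h) 1 one_ne_zero
      exact ⟨n, hn⟩
    · obtain ⟨z, hz, -⟩ := S.exists_hub h ha
      exact ⟨z, hz⟩
  · have : ∀ i : Fin 4, ∃ j, IsConsecutive i j := by decide
    obtain ⟨j, hj⟩ := this i
    obtain ⟨w, hw, -⟩ := S.exists_next h j hj
    exact ⟨w, hw⟩

/-- A vertex of role `inr i` has a neighbor of the same kind. -/
theorem exists_adj_path {v : V} {i : Fin 4} (h : S.role v = .inr i) :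
    ∃ v' j, S.E v v' ∧ S.role v' = .inr j ∧ IsConsecutive i j := by
  have : ∀ i : Fin 4, ∃ j, IsConsecutive i j := by decide
  obtain ⟨j, hj⟩ := this i
  obtain ⟨w, hw, hr⟩ := S.exists_next h j hj
  exact ⟨w, j, hw, hr, hj⟩

/-- An edge between consecutive positions extends to a path through all four positions. -/
theorem exists_lift {u u' : V} {i j : Fin 4} (hu : S.role u = .inr i) (hu' : S.role u' = .inr j)
    (hij : IsConsecutive i j) (h : S.E u u') :
    ∃ f : Fin 4 → V, (∀ k, S.role (f k) = .inr k) ∧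
      (∀ k l, IsConsecutive k l → S.E (f k) (f l)) ∧ f i = u ∧ f j = u' := by
  have build : ∀ a b c d : V, S.role a = .inr 0 → S.role b = .inr 1 → S.role c = .inr 2 →
      S.role d = .inr 3 → S.E a b → S.E b c → S.E c d →
      (∀ k, S.role (![a, b, c, d] k) = .inr k) ∧
      (∀ k l, IsConsecutive k l → S.E (![a, b, c, d] k) (![a, b, c, d] l)) := by
    intro a b c d ha hb hc hd hab hbc hcd
    have hab' := S.symm hab
    have hbc' := S.symm hbc
    have hcd' := S.symm hcd
    refine ⟨fun k => ?_, fun k l hkl => ?_⟩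
    · fin_cases k <;> simpa
    · fin_cases k <;> fin_cases l <;> first | simpa | exact absurd hkl (by decide)
  have from01 : ∀ a b, S.role a = .inr 0 → S.role b = .inr 1 → S.E a b →
      ∃ c d, S.role c = .inr 2 ∧ S.role d = .inr 3 ∧ S.E b c ∧ S.E c d := by
    intro a b _ hb _
    obtain ⟨c, hbc, hc⟩ := S.exists_next hb 2 (by decide)
    obtain ⟨d, hcd, hd⟩ := S.exists_next hc 3 (by decide)
    exact ⟨c, d, hc, hd, hbc, hcd⟩
  have from12 : ∀ b c, S.role b = .inr 1 → S.role c = .inr 2 → S.E b c →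
      ∃ a d, S.role a = .inr 0 ∧ S.role d = .inr 3 ∧ S.E a b ∧ S.E c d := by
    intro b c hb hc _
    obtain ⟨a, hba, ha⟩ := S.exists_next hb 0 (by decide)
    obtain ⟨d, hcd, hd⟩ := S.exists_next hc 3 (by decide)
    exact ⟨a, d, ha, hd, S.symm hba, hcd⟩
  have from23 : ∀ c d, S.role c = .inr 2 → S.role d = .inr 3 → S.E c d →
      ∃ a b, S.role a = .inr 0 ∧ S.role b = .inr 1 ∧ S.E a b ∧ S.E b c := by
    intro c d hc _ _
    obtain ⟨b, hcb, hb⟩ := S.exists_next hc 1 (by decide)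
    obtain ⟨a, hba, ha⟩ := S.exists_next hb 0 (by decide)
    exact ⟨a, b, ha, hb, S.symm hba, S.symm hcb⟩
  have h' := S.symm h
  have cases : ∀ i j : Fin 4, IsConsecutive i j → (i = 0 ∧ j = 1) ∨ (i = 1 ∧ j = 0) ∨
      (i = 1 ∧ j = 2) ∨ (i = 2 ∧ j = 1) ∨ (i = 2 ∧ j = 3) ∨ (i = 3 ∧ j = 2) := by decide
  rcases cases i j hij with ⟨rfl, rfl⟩ | ⟨rfl, rfl⟩ | ⟨rfl, rfl⟩ | ⟨rfl, rfl⟩ | ⟨rfl, rfl⟩ |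
    ⟨rfl, rfl⟩
  · obtain ⟨c, d, hc, hd, h1, h2⟩ := from01 u u' hu hu' h
    exact ⟨_, (build _ _ _ _ hu hu' hc hd h h1 h2).1, (build _ _ _ _ hu hu' hc hd h h1 h2).2,
      rfl, rfl⟩
  · obtain ⟨c, d, hc, hd, h1, h2⟩ := from01 u' u hu' hu h'
    exact ⟨_, (build _ _ _ _ hu' hu hc hd h' h1 h2).1, (build _ _ _ _ hu' hu hc hd h' h1 h2).2,
      rfl, rfl⟩
  · obtain ⟨a, d, ha, hd, h1, h2⟩ := from12 u u' hu hu' h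
    exact ⟨_, (build _ _ _ _ ha hu hu' hd h1 h h2).1, (build _ _ _ _ ha hu hu' hd h1 h h2).2,
      rfl, rfl⟩
  · obtain ⟨a, d, ha, hd, h1, h2⟩ := from12 u' u hu' hu h'
    exact ⟨_, (build _ _ _ _ ha hu' hu hd h1 h' h2).1, (build _ _ _ _ ha hu' hu hd h1 h' h2).2,
      rfl, rfl⟩
  · obtain ⟨a, b, ha, hb, h1, h2⟩ := from23 u u' hu hu' h
    exact ⟨_, (build _ _ _ _ ha hb hu hu' h1 h2 h).1, (build _ _ _ _ ha hb hu hu' h1 h2 h).2,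
      rfl, rfl⟩
  · obtain ⟨a, b, ha, hb, h1, h2⟩ := from23 u' u hu' hu h'
    exact ⟨_, (build _ _ _ _ ha hb hu' hu h1 h2 h').1, (build _ _ _ _ ha hb hu' hu h1 h2 h').2,
      rfl, rfl⟩

/-- The potential on `G □ H` given by two skeletons. Over a hub or a spoke of `G` it alternates
with the bipartition of `H`; over the other vertices of `G` the roles of `G` and `H` are exchanged,
and where both vertices have a position on the path with four vertices, the potential is that of
the product of two such paths. -/
def potential (x : V × W) : ZMod 3 :=
  match S.role x.1, T.role x.2 with
  | .inl a, _ => a * T.sgn x.2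
  | .inr _, .inl b => S.sgn x.1 * b
  | .inr i, .inr j => gridPotential i j

variable {S T} {u u' : V} {v v' : W}

theorem potential_of_inl {a : ZMod 3} (h : S.role u = .inl a) (v : W) :
    S.potential T (u, v) = a * T.sgn v := by
  simp [potential, h]

theorem potential_of_inr_inl {i : Fin 4} {b : ZMod 3} (h : S.role u = .inr i)
    (h' : T.role v = .inl b) : S.potential T (u, v) = S.sgn u * b := by
  simp [potential, h, h']

theorem potential_of_inr_inr {i j : Fin 4} (h : S.role u = .inr i)
    (h' : T.role v = .inr j) : S.potential T (u, v) = gridPotential i j := by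
  simp [potential, h, h']

theorem adj_left (h : S.E u u') (v : W) : (G □ H).Adj (u, v) (u', v) :=
  boxProd_adj.2 (.inl ⟨S.adj h, rfl⟩)

theorem adj_right (h : T.E v v') (u : V) : (G □ H).Adj (u, v) (u, v') :=
  boxProd_adj.2 (.inr ⟨T.adj h, rfl⟩)

variable (S T) in
/-- Mutual reachability in the product of the two skeletons. -/
abbrev Mut (x y : V × W) : Prop := (G □ H).Mutual (S.potential T) x y

theorem mut_hub_left {z n : V} {a : ZMod 3} (hz : S.role z = .inl 0) (hn : S.role n = .inl a)
    (ha : a ≠ 0) (hzn : S.E z n) (hv : T.E v v') :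
    Mut S T (z, v) (n, v) ∧ Mut S T (z, v) (z, v') ∧ Mut S T (z, v) (n, v') := by
  obtain ⟨m, hzm, hm⟩ := S.exists_spoke hz (-a) (neg_ne_zero.2 ha)
  have hs : ∀ a s : ZMod 3, a ≠ 0 → (s = 1 ∨ s = -1) → (a * s = 1 ∨ a * s = -1) := by decide
  refine Mutual.of_hexagon (hs a (T.sgn v) ha (T.sgn_eq v)) (adj_left hzn v) (adj_right hv n)
    (adj_left (S.symm hzn) v') (adj_left hzm v') (adj_right (T.symm hv) m)
    (adj_left (S.symm hzm) v) ?_ ?_ ?_ ?_ ?_ ?_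
  · rw [potential_of_inl hz, zero_mul]
  · rw [potential_of_inl hz, zero_mul]
  · rw [potential_of_inl hn]
  · rw [potential_of_inl hn, T.flip hv]; ring
  · rw [potential_of_inl hm]; ring
  · rw [potential_of_inl hm, T.flip hv]; ring

theorem mut_hub_right {z n : W} {b : ZMod 3} {i j : Fin 4} (hz : T.role z = .inl 0)
    (hn : T.role n = .inl b) (hb : b ≠ 0) (hzn : T.E z n) (hu : S.E u u')
    (hi : S.role u = .inr i) (hj : S.role u' = .inr j) :
    Mut S T (u, z) (u, n) ∧ Mut S T (u, z) (u', z) ∧ Mut S T (u, z) (u', n) := by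
  obtain ⟨m, hzm, hm⟩ := T.exists_spoke hz (-b) (neg_ne_zero.2 hb)
  have hs : ∀ a s : ZMod 3, a ≠ 0 → (s = 1 ∨ s = -1) → (s * a = 1 ∨ s * a = -1) := by decide
  refine Mutual.of_hexagon (hs b (S.sgn u) hb (S.sgn_eq u)) (adj_right hzn u) (adj_left hu n)
    (adj_right (T.symm hzn) u') (adj_right hzm u') (adj_left (S.symm hu) m)
    (adj_right (T.symm hzm) u) ?_ ?_ ?_ ?_ ?_ ?_
  · rw [potential_of_inr_inl hi hz, mul_zero]
  · rw [potential_of_inr_inl hj hz, mul_zero]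
  · rw [potential_of_inr_inl hi hn]
  · rw [potential_of_inr_inl hj hn, S.flip hu]; ring
  · rw [potential_of_inr_inl hi hm]; ring
  · rw [potential_of_inr_inl hj hm, S.flip hu]; ring

/-- The product of two lifted paths with four vertices is strongly connected. -/
theorem mut_grid {f : Fin 4 → V} {g : Fin 4 → W} (hf : ∀ k, S.role (f k) = .inr k)
    (hfE : ∀ k l, IsConsecutive k l → S.E (f k) (f l)) (hg : ∀ k, T.role (g k) = .inr k)
    (hgE : ∀ k l, IsConsecutive k l → T.E (g k) (g l)) (i j k l : Fin 4) :
    Mut S T (f i, g j) (f k, g l) := by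
  let e : Fin 4 × Fin 4 → V × W := fun x => (f x.1, g x.2)
  have hch : (gridTour.map e ++ gridTour.map e).IsChain ((G □ H).Arc (S.potential T)) := by
    rw [← List.map_append, List.isChain_map]
    refine isChain_gridTour.imp fun x y hxy => ⟨?_, ?_⟩
    · obtain ⟨⟨h1, h2⟩ | ⟨h1, h2⟩, -⟩ := hxy
      · simpa [e, h1] using adj_left (H := H) (hfE _ _ h2) (g y.2)
      · simpa [e, h1] using adj_right (G := G) (hgE _ _ h2) (f y.1)
    · simpa [e, potential_of_inr_inr (hf _) (hg _)] using hxy.2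
  exact .of_closed_chain hch (List.mem_map_of_mem (f := e) (mem_gridTour (i, j)))
    (List.mem_map_of_mem (f := e) (mem_gridTour (k, l)))

theorem mut_path_path {i i' j j' : Fin 4} (hu : S.role u = .inr i) (hu' : S.role u' = .inr i')
    (hi : IsConsecutive i i') (h : S.E u u') (hv : T.role v = .inr j) (hv' : T.role v' = .inr j')
    (hj : IsConsecutive j j') (h' : T.E v v') :
    Mut S T (u, v) (u', v) ∧ Mut S T (u, v) (u, v') := by
  obtain ⟨f, hf, hfE, rfl, rfl⟩ := S.exists_lift hu hu' hi h
  obtain ⟨g, hg, hgE, rfl, rfl⟩ := T.exists_lift hv hv' hj h'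
  exact ⟨mut_grid hf hfE hg hgE _ _ _ _, mut_grid hf hfE hg hgE _ _ _ _⟩

/-- Over a hub or a spoke of the first skeleton, the whole fibre lies in one component. -/
theorem mut_fibre {a : ZMod 3} (hu : S.role u = .inl a) (hv : T.E v v') :
    Mut S T (u, v) (u, v') := by
  by_cases ha : a = 0
  · subst ha
    obtain ⟨n, hn, hr⟩ := S.exists_spoke hu 1 one_ne_zero
    exact (mut_hub_left hu hr one_ne_zero hn hv).2.1
  · obtain ⟨z, hz, hr⟩ := S.exists_hub hu ha
    have := mut_hub_left hr hu ha (S.symm hz) hv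
    exact this.1.symm.trans this.2.2

/-- Over a hub or a spoke of the second skeleton, edges between path roles stay in a component. -/
theorem mut_fibre_path {b : ZMod 3} {i j : Fin 4} (hv : T.role v = .inl b) (hu : S.E u u')
    (hi : S.role u = .inr i) (hj : S.role u' = .inr j) : Mut S T (u, v) (u', v) := by
  by_cases hb : b = 0
  · subst hb
    obtain ⟨n, hn, hr⟩ := T.exists_spoke hv 1 one_ne_zero
    exact (mut_hub_right hv hr one_ne_zero hn hu hi hj).2.1
  · obtain ⟨z, hz, hr⟩ := T.exists_hub hv hb
    have := mut_hub_right hr hv hb (T.symm hz) hu hi hj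
    exact this.1.symm.trans this.2.2

variable (S T) in
/-- The gluing relation in the product of the two skeletons. -/
abbrev Glue (x y : V × W) : Prop := Glued (G □ H) (S.potential T) x y

theorem bridge_left {v₂ : W} (h : S.E u u') (h₁ : Mut S T (u, v) (u, v₂))
    (h₂ : Mut S T (u', v) (u', v₂)) (hne : S.potential T (u, v) ≠ S.potential T (u, v₂)) :
    Glue S T (u, v) (u', v) :=
  .bridge h₁ h₂ (adj_left h v) (adj_left h v₂) (.inl hne)

theorem bridge_right {u₂ : V} (h : T.E v v') (h₁ : Mut S T (u, v) (u₂, v))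
    (h₂ : Mut S T (u, v') (u₂, v')) (hne : S.potential T (u, v) ≠ S.potential T (u₂, v)) :
    Glue S T (u, v) (u, v') :=
  .bridge h₁ h₂ (adj_right h u) (adj_right h u₂) (.inl hne)

theorem mul_sgn_ne (v v' : W) (h : T.E v v') {a : ZMod 3} (ha : a ≠ 0) :
    a * T.sgn v ≠ a * T.sgn v' := by
  have : ∀ a s : ZMod 3, a ≠ 0 → (s = 1 ∨ s = -1) → a * s ≠ a * -s := by decide
  rw [T.flip h]
  exact this a _ ha (T.sgn_eq v)

theorem glue_left_of_spoke {a : ZMod 3} (hu : S.role u = .inl a) (ha : a ≠ 0) (h : S.E u u')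
    (v : W) : Glue S T (u, v) (u', v) := by
  have hpot : ∀ v₂, T.E v v₂ → S.potential T (u, v) ≠ S.potential T (u, v₂) := by
    intro v₂ h2
    rw [potential_of_inl hu, potential_of_inl hu]
    exact mul_sgn_ne v v₂ h2 ha
  rcases hu' : S.role u' with a' | i
  · obtain ⟨v₂, h2⟩ := T.exists_adj v
    exact bridge_left h (mut_fibre hu h2) (mut_fibre hu' h2) (hpot v₂ h2)
  · obtain ⟨u₂, i₂, e2, r2, c2⟩ := S.exists_adj_path hu'
    rcases hv : T.role v with b | j
    · obtain ⟨v₂, h2, hm⟩ : ∃ v₂, T.E v v₂ ∧ Mut S T (u', v) (u', v₂) := by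
        by_cases hb : b = 0
        · subst hb
          obtain ⟨n, hn, hr⟩ := T.exists_spoke hv 1 one_ne_zero
          exact ⟨n, hn, (mut_hub_right hv hr one_ne_zero hn e2 hu' r2).1⟩
        · obtain ⟨z, hz, hr⟩ := T.exists_hub hv hb
          exact ⟨z, hz, (mut_hub_right hr hv hb (T.symm hz) e2 hu' r2).1.symm⟩
      exact bridge_left h (mut_fibre hu h2) hm (hpot v₂ h2)
    · obtain ⟨v₂, j₂, e3, r3, c3⟩ := T.exists_adj_path hv
      exact bridge_left h (mut_fibre hu e3) (mut_path_path hu' r2 c2 e2 hv r3 c3 e3).2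
        (hpot v₂ e3)

theorem glue_left (h : S.E u u') (v : W) : Glue S T (u, v) (u', v) := by
  rcases hu : S.role u with a | i
  · by_cases ha : a = 0
    · subst ha
      obtain ⟨b, hb, hr⟩ := S.spoke_of_hub hu h
      exact (glue_left_of_spoke hr hb (S.symm h) v).symm
    · exact glue_left_of_spoke hu ha h v
  rcases hu' : S.role u' with a | i'
  · by_cases ha : a = 0
    · subst ha
      obtain ⟨b, hb, hr⟩ := S.spoke_of_hub hu' (S.symm h)
      rw [hu] at hr
      cases hr
    · exact (glue_left_of_spoke hu' ha (S.symm h) v).symm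
  rcases hv : T.role v with b | j
  · exact .of_mutual (mut_fibre_path hv h hu hu')
  obtain ⟨v₂, j₂, e3, r3, c3⟩ := T.exists_adj_path hv
  by_cases hc : IsConsecutive i i'
  · exact .of_mutual (mut_path_path hu hu' hc h hv r3 c3 e3).1
  · obtain ⟨u₂, i₂, e2, r2, c2⟩ := S.exists_adj_path hu
    obtain ⟨u₃, i₃, e4, r4, c4⟩ := S.exists_adj_path hu'
    refine bridge_left h (mut_path_path hu r2 c2 e2 hv r3 c3 e3).2
      (mut_path_path hu' r4 c4 e4 hv r3 c3 e3).2 ?_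
    rw [potential_of_inr_inr hu hv, potential_of_inr_inr hu r3]
    have hi : i = 0 ∨ i = 3 := by
      rcases S.path_edge hu hu' h with h | h | h
      · exact absurd h hc
      · exact .inl h.1
      · exact .inr h.1
    -- the first and the last row of `gridPotential` have no two equal consecutive entries
    have : ∀ i j k : Fin 4, (i = 0 ∨ i = 3) → IsConsecutive j k →
        gridPotential i j ≠ gridPotential i k := by decide
    exact this i j j₂ hi c3

theorem glue_right_of_path {i : Fin 4} (hu : S.role u = .inr i) (h : T.E v v') :
    Glue S T (u, v) (u, v') := by
  obtain ⟨u₂, i₂, e2, r2, c2⟩ := S.exists_adj_path hu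
  -- horizontal steps at `v` and at `v'` stay in a component
  have hm : ∀ w, Mut S T (u, w) (u₂, w) := by
    intro w
    rcases hw : T.role w with b | j
    · exact mut_fibre_path hw e2 hu r2
    · obtain ⟨w₂, j₂, e3, r3, c3⟩ := T.exists_adj_path hw
      exact (mut_path_path hu r2 c2 e2 hw r3 c3 e3).1
  have hspoke : ∀ w b, T.role w = .inl b → b ≠ 0 →
      S.potential T (u, w) ≠ S.potential T (u₂, w) := by
    intro w b hw hb
    rw [potential_of_inr_inl hu hw, potential_of_inr_inl r2 hw, mul_comm, mul_comm _ b]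
    exact mul_sgn_ne u u₂ e2 hb
  rcases hv : T.role v with b | j
  · by_cases hb : b = 0
    · subst hb
      obtain ⟨b', hb', hr⟩ := T.spoke_of_hub hv h
      exact (bridge_right (T.symm h) (hm v') (hm v) (hspoke v' b' hr hb')).symm
    · exact bridge_right h (hm v) (hm v') (hspoke v b hv hb)
  · -- all columns of `gridPotential` have distinct consecutive entries
    refine bridge_right h (hm v) (hm v') ?_
    rw [potential_of_inr_inr hu hv, potential_of_inr_inr r2 hv]
    have : ∀ i j k : Fin 4, IsConsecutive i j → gridPotential i k ≠ gridPotential j k := by decide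
    exact this i i₂ j c2

theorem glue_right (h : T.E v v') (u : V) : Glue S T (u, v) (u, v') := by
  rcases hu : S.role u with a | i
  · exact .of_mutual (mut_fibre hu h)
  · exact glue_right_of_path hu h

variable (S T) in
/-- Any two vertices of the product of two skeletons are glued. -/
theorem glued (x y : V × W) : Glued (G □ H) (S.potential T) x y := by
  obtain ⟨u, v⟩ := x
  obtain ⟨u', v'⟩ := y
  have h1 : Glue S T (u, v) (u', v) := by
    have := S.conn u u'
    induction this with
    | refl => exact .refl _
    | tail _ h ih => exact ih.trans (glue_left h v)
  have h2 : Glue S T (u', v) (u', v') := by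
    have := T.conn v v'
    induction this with
    | refl => exact .refl _
    | tail _ h ih => exact ih.trans (glue_right h u')
  exact h1.trans h2

end Skeleton

/-! ### Rooted spanning trees -/

/-- A rooted spanning tree of `G`, given by its parent map and its depth function. The parent of the
root is irrelevant. -/
structure RootedTree {V : Type*} (G : SimpleGraph V) where
  /-- the root -/
  root : V
  /-- the parent map -/
  parent : V → V
  /-- the depth function -/
  depth : V → ℕ
  adj_parent : ∀ {v}, v ≠ root → G.Adj v (parent v)
  depth_parent : ∀ {v}, v ≠ root → depth (parent v) + 1 = depth v
  depth_root : depth root = 0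

/-- A breadth-first search tree, whose depth function is the distance from the root. -/
theorem Connected.exists_rootedTree {V : Type*} {G : SimpleGraph V} (hG : G.Connected) (r : V) :
    ∃ T : RootedTree G, T.root = r ∧ ∀ v, T.depth v = G.dist r v := by
  have key : ∀ v, ∃ w, v ≠ r → G.Adj v w ∧ G.dist r w + 1 = G.dist r v := by
    intro v
    by_cases hv : v = r
    · exact ⟨v, fun h => absurd hv h⟩
    obtain ⟨p, hp⟩ := hG.exists_walk_length_eq_dist v r
    cases p with
    | nil => exact absurd rfl hv
    | @cons _ w _ h q =>
      refine ⟨w, fun _ => ⟨h, ?_⟩⟩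
      have h1 : G.dist w r ≤ q.length := dist_le q
      have h2 : G.dist v r ≤ G.dist w r + 1 := by
        have := hG.dist_triangle (u := v) (v := w) (w := r)
        rw [dist_eq_one_iff_adj.2 h] at this
        omega
      rw [Walk.length_cons] at hp
      rw [dist_comm (u := r), dist_comm (u := r)]
      omega
  choose π hπ using key
  exact ⟨⟨r, π, G.dist r, fun hv => (hπ _ hv).1, fun hv => (hπ _ hv).2, dist_self⟩, rfl,
    fun _ => rfl⟩

namespace RootedTree

variable {V : Type*} {G : SimpleGraph V} (T : RootedTree G)

/-- `w` is a child of `v`. -/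
def IsChild (w v : V) : Prop := w ≠ T.root ∧ T.parent w = v

/-- `u` and `v` are adjacent in the tree. -/
def TreeAdj (u v : V) : Prop := T.IsChild u v ∨ T.IsChild v u

variable {T} {u v w : V}

theorem TreeAdj.symm (h : T.TreeAdj u v) : T.TreeAdj v u := Or.symm h

theorem IsChild.adj (h : T.IsChild w v) : G.Adj w v := h.2 ▸ T.adj_parent h.1

theorem IsChild.depth (h : T.IsChild w v) : T.depth w = T.depth v + 1 := by
  rw [← T.depth_parent h.1, h.2]

theorem isChild_parent (h : v ≠ T.root) : T.IsChild v (T.parent v) := ⟨h, rfl⟩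

theorem TreeAdj.adj (h : T.TreeAdj u v) : G.Adj u v := h.elim (·.adj) (·.adj.symm)

theorem TreeAdj.even_iff (h : T.TreeAdj u v) : Even (T.depth v) ↔ ¬ Even (T.depth u) := by
  rcases h with h | h
  · rw [h.depth, Nat.even_add_one, not_not]
  · rw [h.depth, Nat.even_add_one]

theorem depth_eq_zero : T.depth v = 0 ↔ v = T.root := by
  refine ⟨fun h => ?_, fun h => h ▸ T.depth_root⟩
  by_contra hv
  have := T.depth_parent hv
  omega

theorem isChild_root_iff : T.IsChild v T.root ↔ T.depth v = 1 := by
  constructor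
  · intro h
    rw [h.depth, T.depth_root]
  · intro h
    have hv : v ≠ T.root := by
      rintro rfl
      rw [T.depth_root] at h
      omega
    refine ⟨hv, ?_⟩
    rw [← depth_eq_zero]
    have := T.depth_parent hv
    omega

variable (T)

theorem reflTransGen_isChild_root (v : V) : Relation.ReflTransGen T.IsChild v T.root := by
  induction h : T.depth v generalizing v with
  | zero => rw [depth_eq_zero.1 h]
  | succ n ih =>
    have hv : v ≠ T.root := by
      rintro rfl
      rw [T.depth_root] at h
      omega
    refine .head (isChild_parent hv) (ih _ ?_)
    have := T.depth_parent hv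
    omega

theorem reflTransGen_treeAdj (u v : V) : Relation.ReflTransGen T.TreeAdj u v := by
  have : Std.Symm T.TreeAdj := ⟨fun _ _ h => h.symm⟩
  have hroot : ∀ w, Relation.ReflTransGen T.TreeAdj w T.root := fun w =>
    Relation.ReflTransGen.mono (fun _ _ => .inl) _ _ (T.reflTransGen_isChild_root w)
  exact (hroot u).trans (Relation.ReflTransGen.stdSymm.symm _ _ (hroot v))

/-- A set of vertices chosen greedily from the leaves to the root: a vertex is taken unless one of
its children or grandchildren has been taken. -/
theorem exists_packing [Finite V] : ∃ U : V → Prop, ∀ v,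
    U v ↔ ∀ w, T.IsChild w v → ¬ U w ∧ ∀ x, T.IsChild x w → ¬ U x := by
  let r : V → V → Prop := fun w v => T.depth v < T.depth w
  have : IsTrans V r := ⟨fun _ _ _ h h' => lt_trans h' h⟩
  have : Std.Irrefl r := ⟨fun _ h => lt_irrefl _ h⟩
  have wf : WellFounded r := Finite.wellFounded_of_trans_of_irrefl r
  refine ⟨wf.fix fun v ih => ∀ w (h : T.IsChild w v),
    ¬ ih w (by simp [r, h.depth]) ∧
      ∀ x (h' : T.IsChild x w), ¬ ih x (by simp only [r]; rw [h'.depth, h.depth]; omega),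
    fun v => ?_⟩
  rw [wf.fix_eq]

/-- Signs that are opposite at the two ends of each tree path of length two going upwards, with a
prescribed exceptional child of the root. -/
theorem exists_sign {c : V} (hc : T.IsChild c T.root) :
    ∃ σ : V → ZMod 3, (∀ v, σ v = 1 ∨ σ v = -1) ∧ σ c = 1 ∧
    (∀ v, T.IsChild v T.root → v ≠ c → σ v = -1) ∧
    (∀ v, v ≠ T.root → T.parent v ≠ T.root → σ v = -σ (T.parent (T.parent v))) := by
  classical
  have wf : WellFounded fun v w : V => T.depth v < T.depth w := (measure T.depth).wf
  let F : ∀ v : V, (∀ w, T.depth w < T.depth v → ZMod 3) → ZMod 3 := fun v ih =>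
    if h : v ≠ T.root ∧ T.parent v ≠ T.root then
      -ih (T.parent (T.parent v)) (by
        have := T.depth_parent h.1
        have := T.depth_parent h.2
        omega)
    else if v = c then 1 else -1
  have hF : ∀ v, wf.fix F v = F v fun w _ => wf.fix F w := fun v => wf.fix_eq F v
  refine ⟨wf.fix F, fun v => ?_, ?_, fun v hv hvc => ?_, fun v h1 h2 => ?_⟩
  · induction v using wf.induction with
    | _ v ih =>
      rw [hF]
      by_cases h : v ≠ T.root ∧ T.parent v ≠ T.root
      · have hlt : T.depth (T.parent (T.parent v)) < T.depth v := by
          have := T.depth_parent h.1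
          have := T.depth_parent h.2
          omega
        simp only [F, dif_pos h]
        rcases ih _ hlt with h3 | h3 <;> rw [h3] <;> simp
      · simp only [F, dif_neg h]
        by_cases hvc : v = c <;> simp [hvc]
  · rw [hF]
    simp only [F]
    rw [dif_neg fun h => h.2 hc.2]
    simp
  · rw [hF]
    simp only [F]
    rw [dif_neg fun h => h.2 hv.2, if_neg hvc]
  · rw [hF]
    simp only [F]
    rw [dif_pos ⟨h1, h2⟩]

end RootedTree

/-! ### Existence of skeletons -/

/-- A graph with a spanning tree whose root has two children has a skeleton. Call a vertex a centre
if it has a child in the greedy packing `U`; if the root belongs to `U`, one of its children is made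
a centre as well. Every vertex is a centre or adjacent to one, and each centre has a neighbor of its
own, adjacent to no other centre. Isolated centres become hubs, their neighbors spokes; the other
centres take the two inner positions of the path with four vertices, according to the parity of the
depth, and the remaining vertices take its ends. -/
theorem RootedTree.nonempty_skeleton {V : Type*} [Finite V] {G : SimpleGraph V} (T : RootedTree G)
    {c₁ c₂ : V} (h₁ : T.IsChild c₁ T.root) (h₂ : T.IsChild c₂ T.root) (hne : c₂ ≠ c₁) :
    Nonempty (Skeleton G) := by
  classical
  obtain ⟨U, hU⟩ := T.exists_packing
  obtain ⟨σ, hσ, hσ₁, hσroot, hσstep⟩ := T.exists_sign h₁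
  let cen : V → Prop := fun v => (∃ w, T.IsChild w v ∧ U w) ∨ (U T.root ∧ v = c₁)
  have child_or : ∀ v, ¬ U v → ∃ w, T.IsChild w v ∧ (U w ∨ cen w) := by
    intro v hv
    rw [hU] at hv
    push Not at hv
    obtain ⟨w, hw, hw'⟩ := hv
    refine ⟨w, hw, ?_⟩
    by_cases hwU : U w
    · exact .inl hwU
    · obtain ⟨x, hx, hxU⟩ := hw' hwU
      exact .inr (.inl ⟨x, hx, hxU⟩)
  have hdom : ∀ v, ¬ cen v → ∃ z, T.TreeAdj v z ∧ cen z := by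
    intro v hv
    by_cases hvU : U v
    · by_cases hr : v = T.root
      · subst hr
        exact ⟨c₁, .inr h₁, .inr ⟨hvU, rfl⟩⟩
      · exact ⟨T.parent v, .inl (isChild_parent hr), .inl ⟨v, isChild_parent hr, hvU⟩⟩
    · obtain ⟨w, hw, hw' | hw'⟩ := child_or v hvU
      · exact absurd (.inl ⟨w, hw, hw'⟩) hv
      · exact ⟨w, .inr hw, hw'⟩
  have hUcen : ∀ v, U v → ¬ cen v := by
    rintro v hv (⟨w, hw, hwU⟩ | ⟨hr, rfl⟩)
    · exact ((hU v).1 hv w hw).1 hwU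
    · exact ((hU _).1 hr v h₁).1 hv
  have hown : ∀ v, cen v →
      ∃ o, T.TreeAdj v o ∧ ¬ cen o ∧ ∀ z, T.TreeAdj o z → cen z → z = v := by
    rintro v (⟨w, hw, hwU⟩ | ⟨hr, rfl⟩)
    · refine ⟨w, .inr hw, hUcen w hwU, ?_⟩
      rintro z (hz | hz) hzc
      · exact hz.2.symm.trans hw.2
      · rcases hzc with ⟨x, hx, hxU⟩ | ⟨-, rfl⟩
        · exact absurd hxU (((hU w).1 hwU z hz).2 x hx)
        · exact absurd (hz.2.symm.trans h₁.2) hw.1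
    · refine ⟨T.root, .inl h₁, hUcen _ hr, ?_⟩
      rintro z (hz | hz) hzc
      · exact absurd rfl hz.1
      · rcases hzc with ⟨x, hx, hxU⟩ | ⟨-, rfl⟩
        · exact absurd hxU (((hU _).1 hr z hz).2 x hx)
        · rfl
  let hub : V → Prop := fun v => cen v ∧ ∀ v', T.TreeAdj v v' → ¬ cen v'
  let spoke : V → Prop := fun v => ¬ cen v ∧ ∃ z, T.TreeAdj v z ∧ hub z
  let role : V → ZMod 3 ⊕ Fin 4 := fun v =>
    if hub v then .inl 0 else if spoke v then .inl (σ v) else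
      if cen v then (if Even (T.depth v) then .inr 1 else .inr 2)
      else (if Even (T.depth v) then .inr 3 else .inr 0)
  have hσ0 : ∀ v, σ v ≠ 0 := fun v => by rcases hσ v with h | h <;> rw [h] <;> decide
  have role_hub : ∀ {v}, hub v → role v = .inl 0 := fun h => if_pos h
  have spoke_not_hub : ∀ {v}, spoke v → ¬ hub v := fun h h' => h.1 h'.1
  have role_spoke : ∀ {v}, spoke v → role v = .inl (σ v) := fun h => by
    simp only [role]
    rw [if_neg (spoke_not_hub h), if_pos h]
  have role_cen : ∀ {v v'}, cen v → T.TreeAdj v v' → cen v' →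
      role v = if Even (T.depth v) then .inr 1 else .inr 2 := fun h ha h' => by
    simp only [role]
    rw [if_neg fun hh => hh.2 _ ha h', if_neg fun hs => hs.1 h, if_pos h]
  have role_end : ∀ {v}, ¬ cen v → (∀ z, T.TreeAdj v z → ¬ hub z) →
      role v = if Even (T.depth v) then .inr 3 else .inr 0 := fun h h' => by
    simp only [role]
    rw [if_neg fun hh => h hh.1, if_neg fun hs => hs.2.elim fun z hz => h' z hz.1 hz.2, if_neg h]
  have hcases : ∀ v, hub v ∨ spoke v ∨ (cen v ∧ ∃ v', T.TreeAdj v v' ∧ cen v') ∨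
      (¬ cen v ∧ ∀ z, T.TreeAdj v z → ¬ hub z) := by
    intro v
    by_cases hc : cen v
    · by_cases hh : ∃ v', T.TreeAdj v v' ∧ cen v'
      · exact .inr (.inr (.inl ⟨hc, hh⟩))
      · push Not at hh
        exact .inl ⟨hc, hh⟩
    · by_cases hh : ∃ z, T.TreeAdj v z ∧ hub z
      · exact .inr (.inl ⟨hc, hh⟩)
      · push Not at hh
        exact .inr (.inr (.inr ⟨hc, hh⟩))
  have hub_of_role : ∀ {v}, role v = .inl 0 → hub v := by
    intro v hv
    rcases hcases v with h | h | ⟨h, v', ha, h'⟩ | ⟨h, h'⟩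
    · exact h
    · rw [role_spoke h] at hv
      exact absurd (Sum.inl.inj hv) (hσ0 v)
    · rw [role_cen h ha h'] at hv
      split_ifs at hv
    · rw [role_end h h'] at hv
      split_ifs at hv
  have spoke_of_role : ∀ {v a}, role v = .inl a → a ≠ 0 → spoke v := by
    intro v a hv ha0
    rcases hcases v with h | h | ⟨h, v', ha, h'⟩ | ⟨h, h'⟩
    · rw [role_hub h] at hv
      exact absurd (Sum.inl.inj hv).symm ha0
    · exact h
    · rw [role_cen h ha h'] at hv
      split_ifs at hv
    · rw [role_end h h'] at hv
      split_ifs at hv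
  have path_of_role : ∀ {v i}, role v = .inr i →
      (cen v ∧ (∃ v', T.TreeAdj v v' ∧ cen v') ∧
        ((Even (T.depth v) ∧ i = 1) ∨ (¬ Even (T.depth v) ∧ i = 2))) ∨
      (¬ cen v ∧ (∀ z, T.TreeAdj v z → ¬ hub z) ∧
        ((Even (T.depth v) ∧ i = 3) ∨ (¬ Even (T.depth v) ∧ i = 0))) := by
    intro v i hv
    rcases hcases v with h | h | ⟨h, v', ha, h'⟩ | ⟨h, h'⟩
    · rw [role_hub h] at hv
      cases hv
    · rw [role_spoke h] at hv
      cases hv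
    · rw [role_cen h ha h'] at hv
      refine .inl ⟨h, ⟨v', ha, h'⟩, ?_⟩
      by_cases he : Even (T.depth v)
      · rw [if_pos he] at hv
        exact .inl ⟨he, (Sum.inr.inj hv).symm⟩
      · rw [if_neg he] at hv
        exact .inr ⟨he, (Sum.inr.inj hv).symm⟩
    · rw [role_end h h'] at hv
      refine .inr ⟨h, h', ?_⟩
      by_cases he : Even (T.depth v)
      · rw [if_pos he] at hv
        exact .inl ⟨he, (Sum.inr.inj hv).symm⟩
      · rw [if_neg he] at hv
        exact .inr ⟨he, (Sum.inr.inj hv).symm⟩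
  have hparity : ∀ {v i}, role v = .inr i → (Even (T.depth v) ↔ i = 1 ∨ i = 3) := by
    intro v i hv
    rcases path_of_role hv with ⟨-, -, ⟨he, rfl⟩ | ⟨he, rfl⟩⟩ | ⟨-, -, ⟨he, rfl⟩ | ⟨he, rfl⟩⟩ <;>
      simp [he]
  -- the neighbor of its own of a centre that is not a hub
  have hown' : ∀ {v}, cen v → (∃ v', T.TreeAdj v v' ∧ cen v') →
      ∃ o, T.TreeAdj v o ∧ role o = if Even (T.depth o) then .inr 3 else .inr 0 := by
    intro v hv hv'
    obtain ⟨o, hvo, ho, ho'⟩ := hown v hv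
    refine ⟨o, hvo, role_end ho fun z hz hzh => ?_⟩
    obtain ⟨v', ha, hc⟩ := hv'
    rw [ho' z hz hzh.1] at hzh
    exact hzh.2 v' ha hc
  refine ⟨⟨T.TreeAdj, fun v => if Even (T.depth v) then 1 else -1, role, fun h => h.adj,
    fun h => h.symm, T.reflTransGen_treeAdj, fun v => by by_cases h : Even (T.depth v) <;> simp [h],
    fun {u v} h => ?_, fun {z} hz a ha => ?_, fun {z n} hz hn => ?_, fun {n a} hn ha => ?_,
    fun {u i} hu j hij => ?_, fun {u v i j} hu hv huv => ?_⟩⟩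
  · have := h.even_iff
    by_cases hu : Even (T.depth u) <;> simp [this, hu]
  · have hzh := hub_of_role hz
    have hsp : ∀ n, T.TreeAdj z n → role n = .inl (σ n) := fun n hn =>
      role_spoke ⟨hzh.2 n hn, z, hn.symm, hzh⟩
    obtain ⟨n, n', hn, hn', hopp⟩ : ∃ n n', T.TreeAdj z n ∧ T.TreeAdj z n' ∧ σ n' = -σ n := by
      by_cases hr : z = T.root
      · subst hr
        exact ⟨c₁, c₂, .inr h₁, .inr h₂, by rw [hσ₁, hσroot c₂ h₂ hne]⟩
      · obtain ⟨w, hw, -⟩ := child_or z fun hzU => hUcen z hzU hzh.1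
        refine ⟨T.parent z, w, .inl (isChild_parent hr), .inr hw, ?_⟩
        have := hσstep w hw.1 (by rw [hw.2]; exact hr)
        rwa [hw.2] at this
    have hsel : ∀ a s t : ZMod 3, a ≠ 0 → s ≠ 0 → t = -s → a = s ∨ a = t := by decide
    rcases hsel a _ _ ha (hσ0 n) hopp with rfl | rfl
    · exact ⟨n, hn, hsp n hn⟩
    · exact ⟨n', hn', hsp n' hn'⟩
  · have hzh := hub_of_role hz
    exact ⟨σ n, hσ0 n, role_spoke ⟨hzh.2 n hn, z, hn.symm, hzh⟩⟩
  · obtain ⟨-, z, hz, hzh⟩ := spoke_of_role hn ha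
    exact ⟨z, hz, role_hub hzh⟩
  · rcases path_of_role hu with ⟨hc, hc', hi⟩ | ⟨hc, hc', hi⟩
    · obtain ⟨o, huo, ho⟩ := hown' hc hc'
      obtain ⟨v', hv', hcv'⟩ := hc'
      have hrv' := role_cen hcv' hv'.symm hc
      have e1 := huo.even_iff
      have e2 := hv'.even_iff
      rcases hi with ⟨he, rfl⟩ | ⟨he, rfl⟩
      · rw [if_neg (by tauto)] at ho hrv'
        have : ∀ j : Fin 4, IsConsecutive 1 j → j = 0 ∨ j = 2 := by decide
        rcases this j hij with rfl | rfl
        · exact ⟨o, huo, ho⟩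
        · exact ⟨v', hv', hrv'⟩
      · rw [if_pos (by tauto)] at ho hrv'
        have : ∀ j : Fin 4, IsConsecutive 2 j → j = 3 ∨ j = 1 := by decide
        rcases this j hij with rfl | rfl
        · exact ⟨o, huo, ho⟩
        · exact ⟨v', hv', hrv'⟩
    · obtain ⟨z, huz, hz⟩ := hdom u hc
      have hz' : ∃ v', T.TreeAdj z v' ∧ cen v' := by
        by_contra hno
        push Not at hno
        exact hc' z huz ⟨hz, hno⟩
      obtain ⟨v', hv', hcv'⟩ := hz'
      have hrz := role_cen hz hv' hcv'
      have e1 := huz.even_iff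
      rcases hi with ⟨he, rfl⟩ | ⟨he, rfl⟩
      · rw [if_neg (by tauto)] at hrz
        have : ∀ j : Fin 4, IsConsecutive 3 j → j = 2 := by decide
        exact ⟨z, huz, this j hij ▸ hrz⟩
      · rw [if_pos (by tauto)] at hrz
        have : ∀ j : Fin 4, IsConsecutive 0 j → j = 1 := by decide
        exact ⟨z, huz, this j hij ▸ hrz⟩
  · have e := huv.even_iff
    rw [hparity hu, hparity hv] at e
    have : ∀ i j : Fin 4, ((j = 1 ∨ j = 3) ↔ ¬ (i = 1 ∨ i = 3)) →
        IsConsecutive i j ∨ (i = 0 ∧ j = 3) ∨ (i = 3 ∧ j = 0) := by decide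
    exact this i j e

/-- A connected graph with at least three vertices has a vertex with two neighbors. -/
theorem Connected.exists_two_adj {V : Type*} {G : SimpleGraph V} (hG : G.Connected)
    {a b c : V} (hab : a ≠ b) (hac : a ≠ c) (hbc : b ≠ c) :
    ∃ r x y, G.Adj r x ∧ G.Adj r y ∧ y ≠ x := by
  by_contra! h
  have : Nontrivial V := ⟨a, b, hab⟩
  obtain ⟨a', ha⟩ := hG.preconnected.exists_adj_of_nontrivial a
  -- the edge at `a` would be a whole component
  have key : ∀ z, Relation.ReflTransGen G.Adj a z → z = a ∨ z = a' := by
    intro z hz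
    induction hz with
    | refl => exact .inl rfl
    | tail _ hyz ih =>
      rcases ih with rfl | rfl
      · exact .inr (h _ _ _ ha hyz)
      · exact .inl (h _ _ _ ha.symm hyz)
  have hb := key b ((reachable_iff_reflTransGen a b).1 (hG a b))
  have hc := key c ((reachable_iff_reflTransGen a c).1 (hG a c))
  rcases hb with hb | hb
  · exact hab hb.symm
  · rcases hc with hc | hc
    · exact hac hc.symm
    · exact hbc (hb.trans hc.symm)

theorem Connected.nonempty_skeleton {V : Type*} [Finite V] {G : SimpleGraph V} (hG : G.Connected)
    (hV : 3 ≤ Nat.card V) : Nonempty (Skeleton G) := by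
  have := Fintype.ofFinite V
  rw [Nat.card_eq_fintype_card] at hV
  obtain ⟨a, b, c, hab, hac, hbc⟩ := Fintype.two_lt_card_iff.1 hV
  obtain ⟨r, x, y, hx, hy, hxy⟩ := hG.exists_two_adj hab hac hbc
  obtain ⟨T, hr, hd⟩ := hG.exists_rootedTree r
  refine T.nonempty_skeleton (c₁ := x) (c₂ := y) ?_ ?_ hxy
  · rw [RootedTree.isChild_root_iff, hd, dist_eq_one_iff_adj]
    exact hx
  · rw [RootedTree.isChild_root_iff, hd, dist_eq_one_iff_adj]
    exact hy

/-- The product of two connected graphs with at least three vertices each has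
`pc_{1,2}` at most `3`. -/
theorem properConnectionNumber_boxProd_le_three {V W : Type*} [Finite V] [Finite W]
    {G : SimpleGraph V} {H : SimpleGraph W} (hG : G.Connected) (hH : H.Connected)
    (hV : 3 ≤ Nat.card V) (hW : 3 ≤ Nat.card W) :
    (G □ H).properConnectionNumber 1 2 ≤ 3 := by
  obtain ⟨S⟩ := hG.nonempty_skeleton hV
  obtain ⟨T⟩ := hH.nonempty_skeleton hW
  exact properConnectionNumber_le_of_linked (ZMod.card 3)
    (exists_linked_of_glued (Skeleton.glued S T))

/-! ### Prisms over a rooted tree -/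

section Prism

variable {V W K : Type*} {G : SimpleGraph V} {H : SimpleGraph W}

/-- The coloring of `G □ H` by a rooted spanning tree of `H`: copies of an edge of `G` over `w` are
colored `rung w`, and the copy over `s` of the tree edge from `w` to its parent is colored
`side s w`. All other edges get the color `d`. -/
noncomputable def RootedTree.prismColor (T : RootedTree H) (rung : W → K) (side : V → W → K)
    (d : K) : Sym2 (V × W) → K := by
  classical
  exact Sym2.lift ⟨fun x y => if x.2 = y.2 then rung x.2 else
    if T.IsChild x.2 y.2 then side x.1 x.2 else
    if T.IsChild y.2 x.2 then side y.1 y.2 else d, by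
      intro x y
      dsimp only
      by_cases h : x.2 = y.2
      · rw [if_pos h, if_pos h.symm, h]
      rw [if_neg h, if_neg (Ne.symm h)]
      by_cases h1 : T.IsChild x.2 y.2
      · have h2 : ¬ T.IsChild y.2 x.2 := fun h2 => by
          have := h1.depth
          have := h2.depth
          omega
        rw [if_pos h1, if_neg h2, if_pos h1]
      · rw [if_neg h1, if_neg h1]⟩

variable {T : RootedTree H} {rung : W → K} {side : V → W → K} {d : K}

theorem RootedTree.prismColor_rung (s t : V) (w : W) :
    T.prismColor rung side d s((s, w), (t, w)) = rung w := by
  simp [prismColor]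

theorem RootedTree.prismColor_side (s : V) {w v : W} (h : T.IsChild w v) :
    T.prismColor rung side d s((s, w), (s, v)) = side s w := by
  have hne : w ≠ v := h.adj.ne
  simp [prismColor, hne, h]

/-- The tree path from `u` up to an ancestor `x`, in the copy of `H` over `s`. If the sides of the
prism are colored by `ε` times the depth, then the colors along the path form an arithmetic
progression, which would be continued by `ε` times the depth of `x`. -/
theorem RootedTree.exists_path_up (col : Sym2 (V × W) → K) (g : ZMod 3 → K) (s : V) (ε : ZMod 3)
    (hcol : ∀ {w v}, T.IsChild w v → col s((s, w), (s, v)) = g (ε * T.depth w)) {u x : W}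
    (h : Relation.ReflTransGen T.IsChild u x) :
    ∃ p : (G □ H).Walk (s, u) (s, x), p.IsPath ∧
      (∀ y ∈ p.support, y.1 = s ∧ Relation.ReflTransGen T.IsChild u y.2) ∧
      ∃ l : List (ZMod 3), p.edges.map col = l.map g ∧
        (l ++ [ε * T.depth x]).IsChain (fun c c' => c' = c + -ε) ∧
        (l ++ [ε * T.depth x]).head? = some (ε * (T.depth u : ZMod 3)) := by
  induction h using Relation.ReflTransGen.head_induction_on with
  | refl => exact ⟨.nil, .nil, by simp [Relation.ReflTransGen.refl], [], by simp⟩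
  | @head u v huv hvx ih =>
    obtain ⟨p, hp, hsup, l, hl, hch, hhead⟩ := ih
    have hdepth := huv.depth
    have desc : ∀ y, Relation.ReflTransGen T.IsChild v y → T.depth y ≤ T.depth v := by
      intro y hy
      induction hy with
      | refl => exact le_rfl
      | tail _ h ih =>
        have := h.depth
        omega
    have hadj : (G □ H).Adj (s, u) (s, v) := boxProd_adj.2 (.inr ⟨huv.adj, rfl⟩)
    refine ⟨.cons hadj p, ?_, ?_, (ε * T.depth u) :: l, ?_, ?_, ?_⟩
    · rw [Walk.cons_isPath_iff]
      refine ⟨hp, fun hmem => ?_⟩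
      have := desc _ (hsup _ hmem).2
      simp only at this
      omega
    · intro y hy
      rw [Walk.support_cons, List.mem_cons] at hy
      rcases hy with rfl | hy
      · exact ⟨rfl, .refl⟩
      · exact ⟨(hsup y hy).1, .head huv (hsup y hy).2⟩
    · rw [Walk.edges_cons, List.map_cons, List.map_cons, hl, hcol huv]
    · rw [List.cons_append, List.isChain_cons]
      refine ⟨fun c hc => ?_, hch⟩
      rw [hhead] at hc
      obtain rfl := Option.some.inj hc
      rw [hdepth]; push_cast; ring
    · simp

/-- In the prism over a rooted tree of `H`, color the edges at depth `k` by `k` on one side and by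
`-k` on the other, the edge over the root by `0` and all other edges between the two sides by a
fourth color. A path that goes up to the root on the first side and down on the second one is
distance `2`-proper, and so are its extensions by one edge of the fourth color. -/
theorem exists_linked_four_of_prism {a b : V} (hab : G.Adj a b) (hV : ∀ s, s = a ∨ s = b)
    (T : RootedTree H) :
    ∃ col : Sym2 (V × W) → Option (ZMod 3), ∀ x y, (G □ H).Linked col x y := by
  classical
  let col := T.prismColor (fun w => if w = T.root then some (0 : ZMod 3) else none)
    (fun s w => some ((if s = a then 1 else -1) * (T.depth w : ZMod 3))) none
  have hne := hab.ne
  have hcol : ∀ (s : V) {w v}, T.IsChild w v → col s((s, w), (s, v)) =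
      some ((if s = a then 1 else -1) * (T.depth w : ZMod 3)) :=
    fun s {w v} h => T.prismColor_side s h
  have hinj : Function.Injective (some : ZMod 3 → Option (ZMod 3)) := Option.some_injective _
  have hroot := T.reflTransGen_isChild_root
  have hcross : ∀ u x, ∃ p : (G □ H).Walk (a, u) (b, x), p.IsPath ∧
      (∀ y ∈ p.support, (y.1 = a ∧ Relation.ReflTransGen T.IsChild u y.2) ∨
        (y.1 = b ∧ Relation.ReflTransGen T.IsChild x y.2)) ∧
      ∃ l : List (ZMod 3), p.edges.map col = l.map some ∧ l.IsChain fun c c' => c' = c + -1 := by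
    intro u x
    obtain ⟨p, hp, hps, l, hl, hlch, -⟩ := RootedTree.exists_path_up (G := G) col some a 1
      (fun {w v} h => by rw [hcol a h, if_pos rfl]) (hroot u)
    obtain ⟨q, hq, hqs, m, hm, hmch, -⟩ := RootedTree.exists_path_up (G := G) col some b (-1)
      (fun {w v} h => by rw [hcol b h, if_neg hne.symm]) (hroot x)
    have hadj : (G □ H).Adj (a, T.root) (b, T.root) := boxProd_adj.2 (.inl ⟨hab, rfl⟩)
    refine ⟨p.append (.cons hadj q.reverse), ?_, ?_, l ++ 0 :: m.reverse, ?_, ?_⟩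
    · rw [Walk.isPath_def, Walk.support_append, Walk.support_cons, List.tail_cons,
        Walk.support_reverse, List.nodup_append]
      refine ⟨hp.support_nodup, List.nodup_reverse.2 hq.support_nodup, fun y hy z hz hyz => ?_⟩
      subst hyz
      exact hne ((hps y hy).1.symm.trans (hqs y (List.mem_reverse.1 hz)).1)
    · intro y hy
      rw [Walk.support_append, Walk.support_cons, List.tail_cons, Walk.support_reverse,
        List.mem_append, List.mem_reverse] at hy
      exact hy.imp (hps y) (hqs y)
    · have h0 : col s((a, T.root), (b, T.root)) = some 0 := by
        simp only [col]
        rw [T.prismColor_rung, if_pos rfl]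
      rw [Walk.edges_append, Walk.edges_cons, Walk.edges_reverse, List.map_append, List.map_cons,
        List.map_reverse, hl, hm, h0, List.map_append, List.map_cons, List.map_reverse]
    · rw [T.depth_root] at hlch hmch
      rw [Nat.cast_zero, mul_zero] at hlch hmch
      rw [List.isChain_split]
      refine ⟨hlch, ?_⟩
      have : (0 :: m.reverse : List (ZMod 3)) = (m ++ [0]).reverse := by simp
      rw [this, List.isChain_reverse]
      exact hmch.imp fun c c' h => by rw [h]; ring
  have hup : ∀ s u x, Relation.ReflTransGen T.IsChild u x →
      (G □ H).Linked col (s, u) (s, x) := by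
    intro s u x hux
    obtain ⟨p, hp, -, l, hl, hch, -⟩ := RootedTree.exists_path_up (G := G) col some s
      (if s = a then 1 else -1) (fun {w v} h => hcol s h) hux
    refine ⟨p, hp, ?_⟩
    rw [hl]
    refine (spaced_of_isChain (ε := -if s = a then 1 else -1) ?_ hch.left_of_append).map hinj
    split_ifs <;> decide
  have hnone : ∀ s t w, w ≠ T.root → col s((s, w), (t, w)) = none := by
    intro s t w hw
    simp only [col]
    rw [T.prismColor_rung, if_neg hw]
  have hspaced : ∀ {l : List (ZMod 3)}, (l.IsChain fun c c' => c' = c + -1) →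
      Spaced (none :: l.map some) := fun hl =>
    ((spaced_of_isChain (by decide) hl).map hinj).cons (by simp)
  have hab' : ∀ u x, (G □ H).Linked col (a, u) (b, x) := by
    intro u x
    obtain ⟨p, hp, -, l, hl, hch⟩ := hcross u x
    exact ⟨p, hp, by rw [hl]; exact (spaced_of_isChain (by decide) hch).map hinj⟩
  have haa : ∀ u x, (G □ H).Linked col (a, u) (a, x) := by
    intro u x
    by_cases hux : Relation.ReflTransGen T.IsChild u x
    · exact hup a u x hux
    by_cases hxu : Relation.ReflTransGen T.IsChild x u
    · exact (hup a x u hxu).symm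
    obtain ⟨p, hp, hs, l, hl, hch⟩ := hcross u x
    have hx : x ≠ T.root := fun h => hux (h ▸ hroot u)
    have hadj : (G □ H).Adj (a, x) (b, x) := boxProd_adj.2 (.inl ⟨hab, rfl⟩)
    refine Linked.symm ⟨.cons hadj p.reverse, ?_, ?_⟩
    · rw [Walk.cons_isPath_iff, Walk.support_reverse, List.mem_reverse]
      refine ⟨hp.reverse, fun hmem => ?_⟩
      rcases hs _ hmem with h | h
      · exact hux h.2
      · exact hne h.1
    · rw [Walk.edges_cons, List.map_cons, Walk.edges_reverse, List.map_reverse, hl,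
        hnone _ _ _ hx]
      exact ((spaced_of_isChain (by decide) hch).map hinj).reverse.cons (by simp)
  have hbb : ∀ u x, (G □ H).Linked col (b, u) (b, x) := by
    intro u x
    by_cases hux : Relation.ReflTransGen T.IsChild u x
    · exact hup b u x hux
    by_cases hxu : Relation.ReflTransGen T.IsChild x u
    · exact (hup b x u hxu).symm
    obtain ⟨p, hp, hs, l, hl, hch⟩ := hcross u x
    have hu : u ≠ T.root := fun h => hxu (h ▸ hroot x)
    have hadj : (G □ H).Adj (b, u) (a, u) := boxProd_adj.2 (.inl ⟨hab.symm, rfl⟩)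
    refine ⟨.cons hadj p, ?_, ?_⟩
    · rw [Walk.cons_isPath_iff]
      refine ⟨hp, fun hmem => ?_⟩
      rcases hs _ hmem with h | h
      · exact hne h.1.symm
      · exact hxu h.2
    · rw [Walk.edges_cons, List.map_cons, hl, hnone _ _ _ hu]
      exact hspaced hch
  refine ⟨col, ?_⟩
  rintro ⟨s, u⟩ ⟨t, x⟩
  rcases hV s with rfl | rfl <;> rcases hV t with rfl | rfl
  · exact haa u x
  · exact hab' u x
  · exact (hab' x u).symm
  · exact hbb u x

end Prism

/-! ### Progressions along lists of vertices -/

section ProgWalk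

variable {X : Type*} (G : SimpleGraph X) (col : Sym2 X → ZMod 3)

/-- The edge from `x` to `y` is in `G` and has color `c`. -/
def ColoredAdj (c : ZMod 3) (x y : X) : Prop := G.Adj x y ∧ col s(x, y) = c

/-- Consecutive elements of the list are adjacent, by edges of colors `c`, `c + 1`, `c + 2`, … -/
def ProgWalk : ZMod 3 → List X → Prop
  | _, [] => True
  | _, [_] => True
  | c, x :: y :: l => G.ColoredAdj col c x y ∧ ProgWalk (c + 1) (y :: l)

variable {G col}

theorem ColoredAdj.symm {c : ZMod 3} {x y : X} (h : G.ColoredAdj col c x y) :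
    G.ColoredAdj col c y x :=
  ⟨h.1.symm, by rw [Sym2.eq_swap]; exact h.2⟩

theorem ProgWalk.exists_walk {l : List X} {c : ZMod 3} {x y : X}
    (h : G.ProgWalk col c (x :: l)) (hy : y ∈ x :: l) :
    ∃ p : G.Walk x y, p.support <+: x :: l ∧
      ((c - 1) :: p.edges.map col).IsChain fun c c' => c' = c + 1 := by
  induction l generalizing c x with
  | nil =>
    obtain rfl := List.mem_singleton.1 hy
    exact ⟨.nil, by simp⟩
  | cons z l ih =>
    rcases List.mem_cons.1 hy with rfl | hy
    · exact ⟨.nil, by simp⟩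
    · obtain ⟨⟨hadj, hc⟩, h⟩ := h
      obtain ⟨p, hp, hch⟩ := ih h hy
      refine ⟨.cons hadj p, ?_, ?_⟩
      · rw [Walk.support_cons]
        exact List.prefix_cons_inj x |>.2 hp
      · rw [Walk.edges_cons, List.map_cons, hc, List.isChain_cons_cons]
        refine ⟨by ring, ?_⟩
        rwa [add_sub_cancel_right] at hch

/-- Any two vertices of a path whose colors form a progression are linked. -/
theorem ProgWalk.linked {l : List X} {c : ZMod 3} (h : G.ProgWalk col c l) (hl : l.Nodup)
    {x y : X} (hx : x ∈ l) (hy : y ∈ l) : G.Linked col x y := by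
  have first : ∀ {l : List X} {c : ZMod 3} {x y : X}, G.ProgWalk col c (x :: l) →
      (x :: l).Nodup → y ∈ x :: l → G.Linked col x y := by
    intro l c x y h hl hy
    obtain ⟨p, hp, hch⟩ := h.exists_walk hy
    exact Linked.of_isChain one_ne_zero p (p.isPath_def.2 (hl.sublist hp.sublist)) hch.tail
  induction l generalizing c with
  | nil => simp at hx
  | cons z l ih =>
    rcases List.mem_cons.1 hx with rfl | hx'
    · exact first h hl hy
    rcases List.mem_cons.1 hy with rfl | hy'
    · exact (first h hl hx).symm
    cases l with
    | nil => simp at hx'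
    | cons w l => exact ih h.2 hl.of_cons hx' hy'

end ProgWalk

/-! ### Prisms over graphs of radius at most two -/

section PrismThree

variable {V W : Type*} {G : SimpleGraph V} {H : SimpleGraph W}

/-- In the prism over a rooted tree of `H` of height at most `2` with at least three vertices, color
the edge over the root by `0`, those over its children by `1` and those over the grandchildren
by `0`. On the two sides, the edge to the parent gets the colors `2` and `1` at a grandchild of the
root, `1` and `2` at a child that has children itself, `0` and `2` at one chosen childless
child `k`, and `2` and `0` at the other childless children. Any two vertices lie on a path whose
colors form an arithmetic progression and which passes through both copies of the root and of one
or two branches at the root, and possibly of `k`. -/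
theorem exists_linked_three_of_prism {a b : V} (hab : G.Adj a b) (hV : ∀ s, s = a ∨ s = b)
    (T : RootedTree H) (hT : ∀ w, T.depth w ≤ 2) (hW : ∀ w, ∃ w', w' ≠ T.root ∧ w' ≠ w) :
    ∃ col : Sym2 (V × W) → ZMod 3, ∀ x y, (G □ H).Linked col x y := by
  classical
  let r := T.root
  let inner : W → Prop := fun w => T.IsChild w r ∧ ∃ x, T.IsChild x w
  let outer : W → Prop := fun w => T.IsChild w r ∧ ¬ ∃ x, T.IsChild x w
  obtain ⟨k, hk⟩ : ∃ k, ∀ w, outer w → outer k := by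
    by_cases h : ∃ k, outer k
    · exact h.imp fun k hk _ _ => hk
    · exact ⟨r, fun w hw => absurd ⟨w, hw⟩ h⟩
  let col := T.prismColor (fun w => if T.IsChild w r then (1 : ZMod 3) else 0)
    (fun s w => if s = a then (if inner w then 1 else if outer w ∧ w = k then 0 else 2)
      else (if inner w then 2 else if outer w then (if w = k then 2 else 0) else 1)) 0
  have hne := hab.ne
  have hne' := hab.ne.symm
  have inner_not_outer : ∀ {w}, inner w → ¬ outer w := fun h h' => h'.2 h.2
  have rung : ∀ w, (G □ H).ColoredAdj col (if T.IsChild w r then 1 else 0) (a, w) (b, w) :=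
    fun w => ⟨boxProd_adj.2 (.inl ⟨hab, rfl⟩), T.prismColor_rung _ _ _⟩
  have sideA : ∀ {w v}, T.IsChild w v → (G □ H).ColoredAdj col
      (if inner w then 1 else if outer w ∧ w = k then 0 else 2) (a, w) (a, v) := by
    intro w v h
    refine ⟨boxProd_adj.2 (.inr ⟨h.adj, rfl⟩), ?_⟩
    simp only [col]
    rw [T.prismColor_side _ h, if_pos rfl]
  have sideB : ∀ {w v}, T.IsChild w v → (G □ H).ColoredAdj col
      (if inner w then 2 else if outer w then (if w = k then 2 else 0) else 1) (b, w) (b, v) := by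
    intro w v h
    refine ⟨boxProd_adj.2 (.inr ⟨h.adj, rfl⟩), ?_⟩
    simp only [col]
    rw [T.prismColor_side _ h, if_neg hne']
  have nroot : ¬ T.IsChild r r := fun h => h.1 rfl
  -- the colored edges at the root, at inner children, at `k`, at outer children, at grandchildren
  have rr : (G □ H).ColoredAdj col 0 (a, r) (b, r) := by
    have := rung r
    rwa [if_neg nroot] at this
  have pa : ∀ {p}, inner p → (G □ H).ColoredAdj col 1 (a, p) (a, r) := by
    intro p hp
    have := sideA hp.1
    rwa [if_pos hp] at this
  have pb : ∀ {p}, inner p → (G □ H).ColoredAdj col 2 (b, p) (b, r) := by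
    intro p hp
    have := sideB hp.1
    rwa [if_pos hp] at this
  have kk : outer k → (G □ H).ColoredAdj col 1 (a, k) (b, k) := by
    intro h
    have := rung k
    rwa [if_pos h.1] at this
  have ka : outer k → (G □ H).ColoredAdj col 0 (a, k) (a, r) := by
    intro h
    have := sideA h.1
    rwa [if_neg fun hi => inner_not_outer hi h, if_pos ⟨h, rfl⟩] at this
  have kb : outer k → (G □ H).ColoredAdj col 2 (b, k) (b, r) := by
    intro h
    have := sideB h.1
    rwa [if_neg fun hi => inner_not_outer hi h, if_pos h, if_pos rfl] at this
  have ll : ∀ {l}, outer l → (G □ H).ColoredAdj col 1 (a, l) (b, l) := by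
    intro l h
    have := rung l
    rwa [if_pos h.1] at this
  have la : ∀ {l}, outer l → l ≠ k → (G □ H).ColoredAdj col 2 (a, l) (a, r) := by
    intro l h hlk
    have := sideA h.1
    rwa [if_neg fun hi => inner_not_outer hi h, if_neg fun hh => hlk hh.2] at this
  have lb : ∀ {l}, outer l → l ≠ k → (G □ H).ColoredAdj col 0 (b, l) (b, r) := by
    intro l h hlk
    have := sideB h.1
    rwa [if_neg fun hi => inner_not_outer hi h, if_pos h, if_neg hlk] at this
  have qr : ∀ {p q}, inner p → T.IsChild q p → ¬ T.IsChild q r := by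
    intro p q hp hq h
    have h1 : p = r := hq.2.symm.trans h.2
    exact hp.1.1 h1
  have qq : ∀ {p q}, inner p → T.IsChild q p → (G □ H).ColoredAdj col 0 (a, q) (b, q) := by
    intro p q hp hq
    have := rung q
    rwa [if_neg (qr hp hq)] at this
  have qa : ∀ {p q}, inner p → T.IsChild q p → (G □ H).ColoredAdj col 2 (a, q) (a, p) := by
    intro p q hp hq
    have := sideA hq
    rwa [if_neg fun h => qr hp hq h.1, if_neg fun h => qr hp hq h.1.1] at this
  have qb : ∀ {p q}, inner p → T.IsChild q p → (G □ H).ColoredAdj col 1 (b, q) (b, p) := by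
    intro p q hp hq
    have := sideB hq
    rwa [if_neg fun h => qr hp hq h.1, if_neg fun h => qr hp hq h.1] at this
  have ne_of_outer : ∀ {p l}, inner p → outer l → p ≠ l := fun hp hl h =>
    inner_not_outer hp (h ▸ hl)
  have ne_of_grandchild : ∀ {p q c}, inner p → T.IsChild q p → T.IsChild c r → q ≠ c :=
    fun hp hq hc h => qr hp hq (h ▸ hc)
  -- the seven kinds of paths
  have two_inner : ∀ {p q p' q'}, inner p → T.IsChild q p → inner p' → T.IsChild q' p' → p ≠ p' →
      ∀ s t u v, (u = r ∨ u = p ∨ u = q) → (v = r ∨ v = p' ∨ v = q') →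
      (G □ H).Linked col (s, u) (t, v) := by
    intro p q p' q' hp hq hp' hq' hpp s t u v hu hv
    have h : (G □ H).ProgWalk col 2 [(a, p), (a, q), (b, q), (b, p), (b, r), (a, r), (a, p'),
        (a, q'), (b, q'), (b, p')] :=
      ⟨(qa hp hq).symm, qq hp hq, qb hp hq, pb hp, rr.symm, (pa hp').symm, (qa hp' hq').symm,
        qq hp' hq', qb hp' hq', trivial⟩
    have hqq : q ≠ q' := fun h => hpp (hq.2.symm.trans (h ▸ hq'.2))
    have h1 := ne_of_grandchild hp hq hp.1
    have h2 := ne_of_grandchild hp hq hp'.1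
    have h3 := ne_of_grandchild hp' hq' hp.1
    have h4 := ne_of_grandchild hp' hq' hp'.1
    refine h.linked ?_ ?_ ?_
    · simp [hne, hne', hpp, hqq, h1, h2, h4, h1.symm, h3.symm, h4.symm, show p ≠ r from hp.1.1,
        show q ≠ r from hq.1, (show p' ≠ r from hp'.1.1).symm, (show q' ≠ r from hq'.1).symm]
    · rcases hV s with rfl | rfl <;> rcases hu with rfl | rfl | rfl <;> simp
    · rcases hV t with rfl | rfl <;> rcases hv with rfl | rfl | rfl <;> simp
  have one_inner : ∀ {p q}, inner p → T.IsChild q p →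
      ∀ s t u v, (u = r ∨ u = p ∨ u = q) → (v = r ∨ v = p ∨ v = q) →
      (G □ H).Linked col (s, u) (t, v) := by
    intro p q hp hq s t u v hu hv
    have h : (G □ H).ProgWalk col 1 [(a, r), (a, p), (a, q), (b, q), (b, p), (b, r)] :=
      ⟨(pa hp).symm, (qa hp hq).symm, qq hp hq, qb hp hq, pb hp, trivial⟩
    have h1 := ne_of_grandchild hp hq hp.1
    refine h.linked ?_ ?_ ?_
    · simp [hne, h1, h1.symm, show p ≠ r from hp.1.1, show q ≠ r from hq.1,
        (show p ≠ r from hp.1.1).symm, (show q ≠ r from hq.1).symm]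
    · rcases hV s with rfl | rfl <;> rcases hu with rfl | rfl | rfl <;> simp
    · rcases hV t with rfl | rfl <;> rcases hv with rfl | rfl | rfl <;> simp
  have two_children : ∀ {p q q'}, inner p → T.IsChild q p → T.IsChild q' p → q ≠ q' →
      ∀ s t u v, (u = r ∨ u = p ∨ u = q) → (v = r ∨ v = p ∨ v = q') →
      (G □ H).Linked col (s, u) (t, v) := by
    intro p q q' hp hq hq' hqq s t u v hu hv
    have h : (G □ H).ProgWalk col 0 [(a, q), (b, q), (b, p), (b, r), (a, r), (a, p), (a, q'),
        (b, q')] :=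
      ⟨qq hp hq, qb hp hq, pb hp, rr.symm, (pa hp).symm, (qa hp hq').symm, qq hp hq', trivial⟩
    have h1 := ne_of_grandchild hp hq hp.1
    have h2 := ne_of_grandchild hp hq' hp.1
    refine h.linked ?_ ?_ ?_
    · simp [hne, hne', hqq, h1, h2.symm, show p ≠ r from hp.1.1, show q ≠ r from hq.1,
        (show p ≠ r from hp.1.1).symm, (show q' ≠ r from hq'.1).symm]
    · rcases hV s with rfl | rfl <;> rcases hu with rfl | rfl | rfl <;> simp
    · rcases hV t with rfl | rfl <;> rcases hv with rfl | rfl | rfl <;> simp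
  have chosen_inner : ∀ {p q}, outer k → inner p → T.IsChild q p →
      ∀ s t u v, (u = r ∨ u = k) → (v = r ∨ v = k ∨ v = p ∨ v = q) →
      (G □ H).Linked col (s, u) (t, v) := by
    intro p q hk hp hq s t u v hu hv
    have h : (G □ H).ProgWalk col 1 [(a, k), (b, k), (b, r), (a, r), (a, p), (a, q), (b, q),
        (b, p)] :=
      ⟨kk hk, kb hk, rr.symm, (pa hp).symm, (qa hp hq).symm, qq hp hq, qb hp hq, trivial⟩
    have h1 := ne_of_grandchild hp hq hp.1
    have h2 := ne_of_grandchild hp hq hk.1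
    have h3 := ne_of_outer hp hk
    refine h.linked ?_ ?_ ?_
    · simp [hne, hne', h1, h1.symm, h2.symm, h3.symm, show k ≠ r from hk.1.1,
        (show p ≠ r from hp.1.1).symm, (show q ≠ r from hq.1).symm]
    · rcases hV s with rfl | rfl <;> rcases hu with rfl | rfl <;> simp
    · rcases hV t with rfl | rfl <;> rcases hv with rfl | rfl | rfl | rfl <;> simp
  have outer_inner : ∀ {l p q}, outer l → l ≠ k → inner p → T.IsChild q p →
      ∀ s t u v, (u = r ∨ u = l) → (v = r ∨ v = p ∨ v = q) →
      (G □ H).Linked col (s, u) (t, v) := by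
    intro l p q hl hlk hp hq s t u v hu hv
    have hk := hk l hl
    have h : (G □ H).ProgWalk col 2 [(a, p), (a, q), (b, q), (b, p), (b, r), (b, l), (a, l),
        (a, r), (a, k), (b, k)] :=
      ⟨(qa hp hq).symm, qq hp hq, qb hp hq, pb hp, (lb hl hlk).symm, (ll hl).symm, la hl hlk,
        (ka hk).symm, kk hk, trivial⟩
    have h1 := ne_of_grandchild hp hq hp.1
    have h2 := ne_of_grandchild hp hq hk.1
    have h3 := ne_of_grandchild hp hq hl.1
    have h4 := ne_of_outer hp hk
    have h5 := ne_of_outer hp hl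
    refine h.linked ?_ ?_ ?_
    · simp [hne, hne', h1, h1.symm, h2, h3, h4, h5, hlk, show p ≠ r from hp.1.1,
        show q ≠ r from hq.1, show l ≠ r from hl.1.1, (show l ≠ r from hl.1.1).symm,
        (show k ≠ r from hk.1.1).symm]
    · rcases hV s with rfl | rfl <;> rcases hu with rfl | rfl <;> simp
    · rcases hV t with rfl | rfl <;> rcases hv with rfl | rfl | rfl <;> simp
  have two_outer : ∀ {l l'}, outer l → l ≠ k → outer l' → l' ≠ k → l ≠ l' →
      ∀ s t u v, (u = r ∨ u = l) → (v = r ∨ v = l') → (G □ H).Linked col (s, u) (t, v) := by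
    intro l l' hl hlk hl' hlk' hll s t u v hu hv
    have hk := hk l hl
    have h : (G □ H).ProgWalk col 1 [(b, l), (a, l), (a, r), (a, k), (b, k), (b, r), (b, l'),
        (a, l')] :=
      ⟨(ll hl).symm, la hl hlk, (ka hk).symm, kk hk, kb hk, (lb hl' hlk').symm, (ll hl').symm,
        trivial⟩
    refine h.linked ?_ ?_ ?_
    · simp [hne, hne', hll, hlk, hlk'.symm, show l ≠ r from hl.1.1, show k ≠ r from hk.1.1,
        (show k ≠ r from hk.1.1).symm, (show l' ≠ r from hl'.1.1).symm]
    · rcases hV s with rfl | rfl <;> rcases hu with rfl | rfl <;> simp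
    · rcases hV t with rfl | rfl <;> rcases hv with rfl | rfl <;> simp
  have chosen_outer : ∀ {l}, outer l → l ≠ k →
      ∀ s t u v, (u = r ∨ u = k ∨ u = l) → (v = r ∨ v = k ∨ v = l) →
      (G □ H).Linked col (s, u) (t, v) := by
    intro l hl hlk s t u v hu hv
    have hk := hk l hl
    have h : (G □ H).ProgWalk col 0 [(a, r), (a, k), (b, k), (b, r), (b, l), (a, l)] :=
      ⟨(ka hk).symm, kk hk, kb hk, (lb hl hlk).symm, (ll hl).symm, trivial⟩
    refine h.linked ?_ ?_ ?_
    · simp [hne, hne', hlk.symm, show k ≠ r from hk.1.1, (show k ≠ r from hk.1.1).symm,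
        (show l ≠ r from hl.1.1).symm]
    · rcases hV s with rfl | rfl <;> rcases hu with rfl | rfl | rfl <;> simp
    · rcases hV t with rfl | rfl <;> rcases hv with rfl | rfl | rfl <;> simp
  -- every vertex is the root or lies on a branch at the root
  have hbranch : ∀ w, w ≠ r → ∃ c, T.IsChild c r ∧ (w = c ∨ T.IsChild w c) := by
    intro w hw
    by_cases hp : T.parent w = r
    · exact ⟨w, ⟨hw, hp⟩, .inl rfl⟩
    · refine ⟨T.parent w, RootedTree.isChild_root_iff.2 ?_, .inr ⟨hw, rfl⟩⟩
      have h1 := T.depth_parent hw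
      have h2 := T.depth_parent hp
      have h3 := hT w
      omega
  let onBranch : W → W → Prop := fun c u =>
    (inner c ∧ ∃ q, T.IsChild q c ∧ (u = r ∨ u = c ∨ u = q)) ∨ (outer c ∧ (u = r ∨ u = c))
  have hon : ∀ {c u}, T.IsChild c r → (u = r ∨ u = c ∨ T.IsChild u c) → onBranch c u := by
    intro c u hc hu
    by_cases hi : ∃ x, T.IsChild x c
    · left
      refine ⟨⟨hc, hi⟩, ?_⟩
      rcases hu with rfl | rfl | hu
      · exact hi.imp fun q hq => ⟨hq, .inl rfl⟩
      · exact hi.imp fun q hq => ⟨hq, .inr (.inl rfl)⟩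
      · exact ⟨u, hu, .inr (.inr rfl)⟩
    · right
      refine ⟨⟨hc, hi⟩, ?_⟩
      rcases hu with rfl | rfl | hu
      · exact .inl rfl
      · exact .inr rfl
      · exact absurd ⟨u, hu⟩ hi
  have hex : ∀ u, ∃ c, onBranch c u := by
    intro u
    by_cases hu : u = r
    · obtain ⟨w, hw, -⟩ := hW r
      obtain ⟨c, hc, -⟩ := hbranch w hw
      exact ⟨c, hon hc (.inl hu)⟩
    · obtain ⟨c, hc, huc⟩ := hbranch u hu
      exact ⟨c, hon hc (.inr huc)⟩
  have inner_outer : ∀ {p q l}, inner p → T.IsChild q p → outer l →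
      ∀ s t u v, (u = r ∨ u = p ∨ u = q) → (v = r ∨ v = l) →
      (G □ H).Linked col (s, u) (t, v) := by
    intro p q l hp hq hl s t u v hu hv
    by_cases hlk : l = k
    · subst hlk
      exact (chosen_inner hl hp hq t s v u hv (hu.imp_right .inr)).symm
    · exact (outer_inner hl hlk hp hq t s v u hv hu).symm
  refine ⟨col, ?_⟩
  rintro ⟨s, u⟩ ⟨t, v⟩
  obtain ⟨c, hc⟩ := hex u
  obtain ⟨c', hc'⟩ := hex v
  rcases hc with ⟨hp, q, hq, hu⟩ | ⟨hl, hu⟩ <;> rcases hc' with ⟨hp', q', hq', hv⟩ | ⟨hl', hv⟩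
  · by_cases hcc : c = c'
    · subst hcc
      by_cases hqq : q = q'
      · subst hqq
        exact one_inner hp hq s t u v hu hv
      · exact two_children hp hq hq' hqq s t u v hu hv
    · exact two_inner hp hq hp' hq' hcc s t u v hu hv
  · exact inner_outer hp hq hl' s t u v hu hv
  · exact (inner_outer hp' hq' hl t s v u hv hu).symm
  · by_cases hck : c = k
    · subst hck
      by_cases hck' : c' = c
      · -- both vertices lie on the branch of `k`, so a vertex on another branch is needed
        subst hck'
        obtain ⟨w, hw, hwk⟩ := hW c'
        obtain ⟨d, hd, hwd⟩ := hbranch w hw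
        have hdk : d ≠ c' := by
          rintro rfl
          exact hwd.elim hwk fun h => hl.2 ⟨w, h⟩
        rcases hon hd (.inl rfl) with ⟨hp, q, hq, -⟩ | ⟨hd', -⟩
        · exact chosen_inner hl hp hq s t u v hu (hv.imp_right .inl)
        · exact chosen_outer hd' hdk s t u v (hu.imp_right .inl) (hv.imp_right .inl)
      · exact chosen_outer hl' hck' s t u v (hu.imp_right .inl) (hv.imp_right .inr)
    · by_cases hck' : c' = k
      · subst hck'
        exact chosen_outer hl hck s t u v (hu.imp_right .inr) (hv.imp_right .inl)
      · by_cases hcc : c = c'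
        · subst hcc
          exact chosen_outer hl hck s t u v (hu.imp_right .inr) (hv.imp_right .inr)
        · exact two_outer hl hck hl' hck' hcc s t u v hu hv

end PrismThree

/-! ### Factors with two vertices -/

section TwoVertices

variable {V W : Type*} {G : SimpleGraph V} {H : SimpleGraph W}

theorem Connected.exists_adj_of_card_eq_two [Finite V] (hG : G.Connected) (hV : Nat.card V = 2) :
    ∃ a b, G.Adj a b ∧ ∀ s, s = a ∨ s = b := by
  obtain ⟨a, b, -, huniv⟩ := Nat.card_eq_two_iff.1 hV
  have hmem : ∀ s, s = a ∨ s = b := fun s => by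
    simpa using huniv.ge (Set.mem_univ s)
  have : Nontrivial V := Finite.one_lt_card_iff_nontrivial.1 (by omega)
  obtain ⟨c, hc⟩ := hG.preconnected.exists_adj_of_nontrivial a
  rcases hmem c with rfl | rfl
  · exact absurd hc G.irrefl
  · exact ⟨a, c, hc, hmem⟩

theorem Connected.eq_top_of_card_eq_two [Finite V] (hG : G.Connected) (hV : Nat.card V = 2) :
    G = ⊤ := by
  obtain ⟨a, b, hab, hmem⟩ := hG.exists_adj_of_card_eq_two hV
  refine eq_top_iff.2 fun s t hst => ?_
  rcases hmem s with rfl | rfl <;> rcases hmem t with rfl | rfl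
  · exact absurd rfl hst
  · exact hab
  · exact hab.symm
  · exact absurd rfl hst

theorem Connected.isStar_of_card_eq_two [Finite V] (hG : G.Connected) (hV : Nat.card V = 2) :
    G.IsStar := by
  obtain ⟨a, b, hab, hmem⟩ := hG.exists_adj_of_card_eq_two hV
  refine ⟨a, ?_⟩
  rw [hG.eq_top_of_card_eq_two hV]
  ext s t
  rw [starGraph_adj, top_adj]
  refine ⟨fun hst => ⟨hst, ?_⟩, fun h => h.1⟩
  rcases hmem s with h | h
  · exact .inl h
  · exact .inr ((hmem t).resolve_right fun h' => hst (h.trans h'.symm))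

theorem exists_linked_four_of_card_eq_two [Finite V] (hG : G.Connected) (hH : H.Connected)
    (hV : Nat.card V = 2) :
    ∃ col : Sym2 (V × W) → Option (ZMod 3), ∀ x y, (G □ H).Linked col x y := by
  obtain ⟨a, b, hab, hmem⟩ := hG.exists_adj_of_card_eq_two hV
  obtain ⟨r⟩ := hH.nonempty
  obtain ⟨T, -, -⟩ := hH.exists_rootedTree r
  exact exists_linked_four_of_prism hab hmem T

/-- If some spanning tree of `H` has radius at most `2`, then so has `H`, and a breadth-first search
tree from a center has height at most `2`. -/
theorem exists_linked_three_of_card_eq_two [Finite V] [Finite W] (hG : G.Connected)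
    (hH : H.Connected) (hV : Nat.card V = 2) (hW : 3 ≤ Nat.card W) {F : SimpleGraph W}
    (hF : F.IsSpanningTree H) (hrad : F.radius < 3) :
    ∃ col : Sym2 (V × W) → ZMod 3, ∀ x y, (G □ H).Linked col x y := by
  obtain ⟨a, b, hab, hmem⟩ := hG.exists_adj_of_card_eq_two hV
  have := hH.nonempty
  obtain ⟨r, hr⟩ := F.exists_eccent_eq_radius
  obtain ⟨T, -, hd⟩ := hH.exists_rootedTree r
  refine exists_linked_three_of_prism hab hmem T (fun w => ?_) fun w => ?_
  · have h1 : F.edist r w < 3 := (edist_le_eccent.trans hr.le).trans_lt hrad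
    have h2 : H.edist r w < 3 := (edist_anti hF.1).trans_lt h1
    rw [hd, SimpleGraph.dist]
    have h3 : ((H.edist r w).toNat : ℕ∞) < 3 := (ENat.natCast_toNat_le_self _).trans_lt h2
    have h4 : (H.edist r w).toNat < 3 := by exact_mod_cast h3
    omega
  · by_contra! h
    have hsub : (Set.univ : Set W) ⊆ {T.root, w} := fun x _ => by
      by_cases hx : x = T.root
      · exact .inl hx
      · exact .inr (h x hx)
    have := Set.ncard_le_ncard hsub (Set.toFinite _)
    rw [Set.ncard_univ] at this
    have := Set.ncard_insert_le T.root {w}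
    rw [Set.ncard_singleton] at this
    omega

theorem exists_linked_boxProd_comm {K : Type*}
    (h : ∃ col : Sym2 (W × V) → K, ∀ x y, (H □ G).Linked col x y) :
    ∃ col : Sym2 (V × W) → K, ∀ x y, (G □ H).Linked col x y := by
  obtain ⟨col, hcol⟩ := h
  exact ⟨_, fun x y => Linked.of_iso (boxProdComm G H) (hcol _ _)⟩

end TwoVertices

end SimpleGraph

theorem theorem4p2 {V W : Type*} [Finite V] [Finite W] [Nontrivial V] [Nontrivial W]
    (G : SimpleGraph V) (H : SimpleGraph W) (hG : G.Connected) (hH : H.Connected)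
    (hGH : ¬ (G = ⊤ ∧ H = ⊤)) :
    (¬ (G.IsStarLargeRadiusPair H ∨ H.IsStarLargeRadiusPair G) →
      (G.boxProd H).properConnectionNumber 1 2 = 3) ∧
    ((G.IsStarLargeRadiusPair H ∨ H.IsStarLargeRadiusPair G) →
      (G.boxProd H).properConnectionNumber 1 2 ≤ 4) := by
  have hV : Nat.card V = 2 ∨ 3 ≤ Nat.card V := by
    have := Finite.one_lt_card (α := V)
    omega
  have hW : Nat.card W = 2 ∨ 3 ≤ Nat.card W := by
    have := Finite.one_lt_card (α := W)
    omega
  have hcard : Fintype.card (Option (ZMod 3)) = 4 := by simp [ZMod.card]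
  refine ⟨fun hex => le_antisymm ?_ ?_, fun _ => ?_⟩
  · push Not at hex
    rcases hV with hV | hV
    · have hW : 3 ≤ Nat.card W := hW.resolve_left fun h =>
        hGH ⟨hG.eq_top_of_card_eq_two hV, hH.eq_top_of_card_eq_two h⟩
      have hstar := hG.isStar_of_card_eq_two hV
      obtain ⟨F, hF, hrad⟩ : ∃ F : SimpleGraph W, F.IsSpanningTree H ∧ F.radius < 3 := by
        by_contra! h
        exact hex.1 ⟨hstar, h⟩
      exact SimpleGraph.properConnectionNumber_le_of_linked (ZMod.card 3)
        (SimpleGraph.exists_linked_three_of_card_eq_two hG hH hV hW hF hrad)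
    rcases hW with hW | hW
    · have hstar := hH.isStar_of_card_eq_two hW
      obtain ⟨F, hF, hrad⟩ : ∃ F : SimpleGraph V, F.IsSpanningTree G ∧ F.radius < 3 := by
        by_contra! h
        exact hex.2 ⟨hstar, h⟩
      exact SimpleGraph.properConnectionNumber_le_of_linked (ZMod.card 3)
        (SimpleGraph.exists_linked_boxProd_comm
          (SimpleGraph.exists_linked_three_of_card_eq_two hH hG hW hV hF hrad))
    · exact SimpleGraph.properConnectionNumber_boxProd_le_three hG hH hV hW
  · exact SimpleGraph.three_le_properConnectionNumber_boxProd G H hGH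
  · rcases hV with hV | hV
    · exact SimpleGraph.properConnectionNumber_le_of_linked hcard
        (SimpleGraph.exists_linked_four_of_card_eq_two hG hH hV)
    rcases hW with hW | hW
    · exact SimpleGraph.properConnectionNumber_le_of_linked hcard
        (SimpleGraph.exists_linked_boxProd_comm
          (SimpleGraph.exists_linked_four_of_card_eq_two hH hG hW))
    · exact (SimpleGraph.properConnectionNumber_boxProd_le_three hG hH hV hW).trans (by norm_num)
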